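/- All Hilbert spaces are complex and separable, possibly infinite-dimensional; $\otimes$ is the Hilbert-space tensor product, and subscripts denote marginals (partial traces). For states $\rho,\sigma$ with spectral decompositions $\rho=\sum_i p(i)|\phi_i\rangle\langle\phi_i|$, $\sigma=\sum_j q(j)|\psi_j\rangle\langle\psi_j|$ over orthonormal bases, the quantum relative entropy is $$D(\rho\|\sigma)=\frac1{\ln 2}\sum_{i,j}|\langle\phi_i|\psi_j\rangle|^2\Big[p(i)\ln\frac{p(i)}{q(j)}+q(j)-p(i)\Big]\in[0,\infty],$$ with $0\ln 0=0\ln\frac00=0$, $\ln\frac c0=+\infty$ for $c>0$, and $0\cdot\infty=0$. The mutual information of a state is $I(A;B)_\rho=D(\rho_{AB}\|\rho_A\otimes\rho_B)$; for a positive semi-definite trace-class operator $\omega_{AB}\neq0$ put $I(A;B)_\omega=\operatorname{Tr}\{\omega\}\,I(A;B)_{\omega/\operatorname{Tr}\{\omega\}}$, and $I(A;B)_0=0$. The conditional mutual information of a state $\omega_{ABE}$ is $$I(A;B|E)_\omega=\sup_{P_A}\big[I(A;BE)_{Q_A\omega Q_A}-I(A;E)_{Q_A\omega Q_A}\big]\in[0,\infty],\qquad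 Q_A=P_A\otimes I_{BE},$$ the supremum being over the finite-rank orthogonal projections $P_A$ on $\mathcal H_A$. For $m\ge1$ and a state $\rho_{A_1\cdots A_mE}$, the conditional total correlation and the conditional dual total correlation are $$I(A_1;\cdots;A_m|E)_\rho=\sum_{i=2}^m I(A_i;A_1\cdots A_{i-1}|E)_\rho,\qquad \widetilde I(A_1;\cdots;A_m|E)_\rho=\sum_{i=2}^m I(A_i;A_1\cdots A_{i-1}|A_{i+1}\cdots A_mE)_\rho .$$ Theorem. Let $m\ge1$ and let $\phi_{A_1\cdots A_mEF}=|\psi\rangle\langle\psi|$, with $\psi$ a unit vector of $\mathcal H_{A_1}\otimes\cdots\otimes\mathcal H_{A_m}\otimes\mathcal H_E\otimes\mathcal H_F$, be a pure state. Then, as an equality in $[0,\infty]$, $$I(A_1;\cdots;A_m|E)_\phi=\widetilde I(A_1;\cdots;A_m|F)_\phi .$$ -/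

import Mathlib

open scoped TensorProduct ENNReal InnerProductSpace

universe u

noncomputable section

namespace QInfo

/-! ### Hilbert-space tensor products -/

/-- The Hilbert-space tensor product of two complex inner product spaces: the completion of the
algebraic tensor product for `⟪a ⊗ b, c ⊗ d⟫ = ⟪a, c⟫ * ⟪b, d⟫`. -/
abbrev HTensor (H K : Type*) [NormedAddCommGroup H] [InnerProductSpace ℂ H]
    [NormedAddCommGroup K] [InnerProductSpace ℂ K] : Type _ :=
  UniformSpace.Completion (H ⊗[ℂ] K)

infixl:70 " ⊗ʰ " => HTensor

section Tensor

variable {H K L M : Type*}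
  [NormedAddCommGroup H] [InnerProductSpace ℂ H]
  [NormedAddCommGroup K] [InnerProductSpace ℂ K]
  [NormedAddCommGroup L] [InnerProductSpace ℂ L]
  [NormedAddCommGroup M] [InnerProductSpace ℂ M]

/-- The product vector `x ⊗ y`. -/
def prodVec (x : H) (y : K) : H ⊗ʰ K := ((x ⊗ₜ[ℂ] y : H ⊗[ℂ] K) : UniformSpace.Completion _)

/-- The tensor product `f ⊗ g` of two bounded operators. -/
def opTensor (f : H →L[ℂ] L) (g : K →L[ℂ] M) : H ⊗ʰ K →L[ℂ] L ⊗ʰ M :=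
  (UniformSpace.Completion.toComplL ∘L TensorProduct.mapL f g).extend
    (UniformSpace.Completion.toComplL : H ⊗[ℂ] K →L[ℂ] H ⊗ʰ K)

theorem opTensor_coe (f : H →L[ℂ] L) (g : K →L[ℂ] M) (x : H ⊗[ℂ] K) :
    opTensor f g (x : H ⊗ʰ K) = (TensorProduct.mapL f g x : L ⊗ʰ M) :=
  ContinuousLinearMap.extend_eq (e := UniformSpace.Completion.toComplL) _
    UniformSpace.Completion.denseRange_coe
    (UniformSpace.Completion.isUniformInducing_coe _) x

theorem opTensor_prodVec (f : H →L[ℂ] L) (g : K →L[ℂ] M) (x : H) (y : K) :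
    opTensor f g (prodVec x y) = prodVec (f x) (g y) := by
  simp only [prodVec, opTensor_coe, TensorProduct.mapL_tmul]

/-- The operator `x ↦ x ⊗ k`. -/
def insertRight (H : Type*) [NormedAddCommGroup H] [InnerProductSpace ℂ H] (k : K) :
    H →L[ℂ] H ⊗ʰ K :=
  UniformSpace.Completion.toComplL ∘L (TensorProduct.mkL ℂ H K).flip k

/-- The operator `x ↦ k ⊗ x`. -/
def insertLeft (H : Type*) [NormedAddCommGroup H] [InnerProductSpace ℂ H] (k : K) :
    H →L[ℂ] K ⊗ʰ H :=
  UniformSpace.Completion.toComplL ∘L TensorProduct.mkL ℂ K H k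

theorem insertRight_apply (k : K) (x : H) : insertRight H k x = prodVec x k := rfl

theorem insertLeft_apply (k : K) (x : H) : insertLeft H k x = prodVec k x := rfl

/-- The unitary `H ⊗ K ≃ K ⊗ H` with `x ⊗ y ↦ y ⊗ x`. -/
def swapU (H K : Type*) [NormedAddCommGroup H] [InnerProductSpace ℂ H]
    [NormedAddCommGroup K] [InnerProductSpace ℂ K] : H ⊗ʰ K ≃ₗᵢ[ℂ] K ⊗ʰ H :=
  (TensorProduct.comm ℂ H K).extendOfIsometry
    (UniformSpace.Completion.toComplL : H ⊗[ℂ] K →L[ℂ] H ⊗ʰ K).toLinearMap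
    (UniformSpace.Completion.toComplL : K ⊗[ℂ] H →L[ℂ] K ⊗ʰ H).toLinearMap
    UniformSpace.Completion.denseRange_coe UniformSpace.Completion.denseRange_coe
    (fun x => by simp)

theorem swapU_prodVec (x : H) (y : K) : swapU H K (prodVec x y) = prodVec y x :=
  LinearEquiv.extendOfIsometry_eq (TensorProduct.comm ℂ H K) _ _ _ _ (fun x => by simp)
    (x ⊗ₜ[ℂ] y)

theorem denseRange_map {f : H →L[ℂ] L} {g : K →L[ℂ] M} (hf : DenseRange f) (hg : DenseRange g) :
    DenseRange (TensorProduct.mapL f g) := by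
  have key : (⊤ : Submodule ℂ (L ⊗[ℂ] M)) ≤
      (LinearMap.range (TensorProduct.mapL f g).toLinearMap).topologicalClosure := by
    rw [← TensorProduct.span_tmul_eq_top, Submodule.span_le]
    rintro _ ⟨a, b, rfl⟩
    have hd : DenseRange (Prod.map f g) := hf.prodMap hg
    have h2 : Continuous fun p : L × M => p.1 ⊗ₜ[ℂ] p.2 := TensorProduct.continuous_tmul
    have h1 : (a, b) ∈ closure (Set.range (Prod.map f g)) := hd (a, b)
    have h3 := h2.range_subset_closure_image_dense hd
    have h4 : a ⊗ₜ[ℂ] b ∈ closure ((fun p : L × M => p.1 ⊗ₜ[ℂ] p.2) ''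
      Set.range (Prod.map f g)) := h3 ⟨(a, b), rfl⟩
    refine closure_mono ?_ h4
    rintro _ ⟨_, ⟨⟨x, y⟩, rfl⟩, rfl⟩
    exact ⟨x ⊗ₜ[ℂ] y, rfl⟩
  intro z
  exact key (Submodule.mem_top : z ∈ _)

/-- The dense isometric inclusion of the algebraic triple tensor product, bracketed to the left. -/
def inclLeft (H K L : Type*) [NormedAddCommGroup H] [InnerProductSpace ℂ H]
    [NormedAddCommGroup K] [InnerProductSpace ℂ K] [NormedAddCommGroup L] [InnerProductSpace ℂ L] :
    (H ⊗[ℂ] K) ⊗[ℂ] L →ₗᵢ[ℂ] (H ⊗ʰ K) ⊗ʰ L :=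
  UniformSpace.Completion.toComplₗᵢ.comp
    (TensorProduct.mapIsometry UniformSpace.Completion.toComplₗᵢ LinearIsometry.id)

/-- The dense isometric inclusion of the algebraic triple tensor product, bracketed to the right. -/
def inclRight (H K L : Type*) [NormedAddCommGroup H] [InnerProductSpace ℂ H]
    [NormedAddCommGroup K] [InnerProductSpace ℂ K] [NormedAddCommGroup L] [InnerProductSpace ℂ L] :
    H ⊗[ℂ] (K ⊗[ℂ] L) →ₗᵢ[ℂ] H ⊗ʰ (K ⊗ʰ L) :=
  UniformSpace.Completion.toComplₗᵢ.comp
    (TensorProduct.mapIsometry LinearIsometry.id UniformSpace.Completion.toComplₗᵢ)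

theorem denseRange_inclLeft : DenseRange (inclLeft H K L).toLinearMap := by
  have h : DenseRange (TensorProduct.mapL
      (UniformSpace.Completion.toComplL : H ⊗[ℂ] K →L[ℂ] H ⊗ʰ K) (ContinuousLinearMap.id ℂ L)) :=
    denseRange_map UniformSpace.Completion.denseRange_coe denseRange_id
  have e : ⇑(inclLeft H K L).toLinearMap = (UniformSpace.Completion.coe' : _ → _) ∘
      TensorProduct.mapL (UniformSpace.Completion.toComplL : H ⊗[ℂ] K →L[ℂ] H ⊗ʰ K) (ContinuousLinearMap.id ℂ L) := by
    ext x
    simp only [Function.comp_apply, TensorProduct.mapL_apply]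
    rfl
  rw [e]
  exact UniformSpace.Completion.denseRange_coe.comp h (UniformSpace.Completion.continuous_coe _)

theorem denseRange_inclRight : DenseRange (inclRight H K L).toLinearMap := by
  have h : DenseRange (TensorProduct.mapL (ContinuousLinearMap.id ℂ H)
      (UniformSpace.Completion.toComplL : K ⊗[ℂ] L →L[ℂ] K ⊗ʰ L)) :=
    denseRange_map denseRange_id UniformSpace.Completion.denseRange_coe
  have e : ⇑(inclRight H K L).toLinearMap = (UniformSpace.Completion.coe' : _ → _) ∘
      TensorProduct.mapL (ContinuousLinearMap.id ℂ H) (UniformSpace.Completion.toComplL : K ⊗[ℂ] L →L[ℂ] K ⊗ʰ L) := by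
    ext x
    simp only [Function.comp_apply, TensorProduct.mapL_apply]
    rfl
  rw [e]
  exact UniformSpace.Completion.denseRange_coe.comp h (UniformSpace.Completion.continuous_coe _)

/-- The unitary `(H ⊗ K) ⊗ L ≃ H ⊗ (K ⊗ L)` with `(x ⊗ y) ⊗ z ↦ x ⊗ (y ⊗ z)`. -/
def assocU (H K L : Type*) [NormedAddCommGroup H] [InnerProductSpace ℂ H]
    [NormedAddCommGroup K] [InnerProductSpace ℂ K] [NormedAddCommGroup L] [InnerProductSpace ℂ L] :
    (H ⊗ʰ K) ⊗ʰ L ≃ₗᵢ[ℂ] H ⊗ʰ (K ⊗ʰ L) :=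
  (TensorProduct.assoc ℂ H K L).extendOfIsometry (inclLeft H K L).toLinearMap
    (inclRight H K L).toLinearMap denseRange_inclLeft denseRange_inclRight
    (fun x => by
      rw [LinearIsometry.coe_toLinearMap, LinearIsometry.coe_toLinearMap, LinearIsometry.norm_map,
        LinearIsometry.norm_map, TensorProduct.norm_assoc])

theorem assocU_prodVec (x : H) (y : K) (z : L) :
    assocU H K L (prodVec (prodVec x y) z) = prodVec x (prodVec y z) :=
  LinearEquiv.extendOfIsometry_eq (TensorProduct.assoc ℂ H K L) (inclLeft H K L).toLinearMap
    (inclRight H K L).toLinearMap denseRange_inclLeft denseRange_inclRight _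
    ((x ⊗ₜ[ℂ] y) ⊗ₜ[ℂ] z)

/-- The unitary `U ⊗ 1`. -/
def congrU (U : H ≃ₗᵢ[ℂ] L) (K : Type*) [NormedAddCommGroup K] [InnerProductSpace ℂ K] :
    H ⊗ʰ K ≃ₗᵢ[ℂ] L ⊗ʰ K :=
  (TensorProduct.congr U.toLinearEquiv (LinearEquiv.refl ℂ K)).extendOfIsometry
    (UniformSpace.Completion.toComplL : H ⊗[ℂ] K →L[ℂ] H ⊗ʰ K).toLinearMap
    (UniformSpace.Completion.toComplL : L ⊗[ℂ] K →L[ℂ] L ⊗ʰ K).toLinearMap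
    UniformSpace.Completion.denseRange_coe UniformSpace.Completion.denseRange_coe
    (fun x => by
      simp only [ContinuousLinearMap.coe_coe, UniformSpace.Completion.coe_toComplL,
        UniformSpace.Completion.norm_coe]
      exact (TensorProduct.congrIsometry U (LinearIsometryEquiv.refl ℂ K)).norm_map x)

theorem congrU_prodVec (U : H ≃ₗᵢ[ℂ] L) (x : H) (y : K) :
    congrU U K (prodVec x y) = prodVec (U x) y :=
  LinearEquiv.extendOfIsometry_eq (TensorProduct.congr U.toLinearEquiv (LinearEquiv.refl ℂ K))
    (UniformSpace.Completion.toComplL : H ⊗[ℂ] K →L[ℂ] H ⊗ʰ K).toLinearMap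
    (UniformSpace.Completion.toComplL : L ⊗[ℂ] K →L[ℂ] L ⊗ʰ K).toLinearMap
    UniformSpace.Completion.denseRange_coe UniformSpace.Completion.denseRange_coe _
    (x ⊗ₜ[ℂ] y)

instance instSeparableTensor [TopologicalSpace.SeparableSpace H]
    [TopologicalSpace.SeparableSpace K] : TopologicalSpace.SeparableSpace (H ⊗[ℂ] K) := by
  have h1 : TopologicalSpace.IsSeparable
      (Set.range fun p : H × K => p.1 ⊗ₜ[ℂ] p.2) :=
    TopologicalSpace.isSeparable_range TensorProduct.continuous_tmul
  have h2 := h1.span (R := ℂ)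
  have h3 : Submodule.span ℂ (Set.range fun p : H × K => p.1 ⊗ₜ[ℂ] p.2) = ⊤ := by
    rw [← TensorProduct.span_tmul_eq_top]
    congr 1
    ext t
    simp
  rw [h3] at h2
  exact TopologicalSpace.isSeparable_univ_iff.mp h2

end Tensor

/-! ### States, traces, partial traces -/

section Operators

variable {H K L : Type*}
  [NormedAddCommGroup H] [InnerProductSpace ℂ H] [CompleteSpace H]
  [NormedAddCommGroup K] [InnerProductSpace ℂ K] [CompleteSpace K]
  [NormedAddCommGroup L] [InnerProductSpace ℂ L] [CompleteSpace L]

/-- `ρ` is a pure state: `ρ = |ψ⟩⟨ψ|` for some unit vector `ψ`. -/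
def IsPureState (ρ : H →L[ℂ] H) : Prop :=
  ∃ ψ : H, ‖ψ‖ = 1 ∧ ρ = InnerProductSpace.rankOne ℂ ψ ψ

/-- The index set of some fixed orthonormal (Hilbert) basis of `H`. -/
def onbIndex (H : Type*) [NormedAddCommGroup H] [InnerProductSpace ℂ H] [CompleteSpace H] :
    Set H :=
  (exists_hilbertBasis ℂ H).choose

/-- Some fixed orthonormal (Hilbert) basis of `H`, used to write traces and partial traces. -/
def onb (H : Type*) [NormedAddCommGroup H] [InnerProductSpace ℂ H] [CompleteSpace H] :
    HilbertBasis (onbIndex H) ℂ H :=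
  (exists_hilbertBasis ℂ H).choose_spec.choose

/-- The trace `∑ₖ ⟨eₖ, ρ eₖ⟩ ∈ [0, ∞]` of a positive operator `ρ`. -/
def opTrace (ρ : H →L[ℂ] H) : ℝ≥0∞ :=
  ∑' k, ENNReal.ofReal (⟪onb H k, ρ (onb H k)⟫_ℂ).re

/-- `U ρ U†`. -/
def conjU (U : H ≃ₗᵢ[ℂ] K) (ρ : H →L[ℂ] H) : K →L[ℂ] K :=
  U.toContinuousLinearEquiv.toContinuousLinearMap ∘L ρ ∘L
    U.symm.toContinuousLinearEquiv.toContinuousLinearMap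

/-- `∑ₖ (V eₖ)† ρ (V eₖ)`, the sum over an orthonormal basis `(eₖ)` of `K` (norm convergent for
positive trace-class `ρ` and the three insertions `V` used below, and then basis independent). -/
def traceAlong (V : K → (H →L[ℂ] L)) (ρ : L →L[ℂ] L) : H →L[ℂ] H :=
  ∑' k, (V (onb K k)).adjoint ∘L ρ ∘L V (onb K k)

/-- The partial trace `Tr_K` of an operator on `H ⊗ K`. -/
def traceRight (ρ : H ⊗ʰ K →L[ℂ] H ⊗ʰ K) : H →L[ℂ] H :=
  traceAlong (fun k : K => insertRight H k) ρ

/-- The partial trace `Tr_H` of an operator on `H ⊗ K`. -/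
def traceLeft (ρ : H ⊗ʰ K →L[ℂ] H ⊗ʰ K) : K →L[ℂ] K :=
  traceAlong (fun h : H => insertLeft K h) ρ

/-- The partial trace `Tr_K` of an operator on `(H ⊗ K) ⊗ L`. -/
def traceMid (ρ : (H ⊗ʰ K) ⊗ʰ L →L[ℂ] (H ⊗ʰ K) ⊗ʰ L) : H ⊗ʰ L →L[ℂ] H ⊗ʰ L :=
  traceAlong (fun k : K => opTensor (insertRight H k) (ContinuousLinearMap.id ℂ L)) ρ

/-! ### Relative entropy and mutual information -/

/-- A spectral decomposition `ρ = ∑ᵢ p(i) |φᵢ⟩⟨φᵢ|` with `(φᵢ)` an orthonormal basis. -/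
structure SpectralDecomposition (ρ : H →L[ℂ] H) where
  index : Set H
  basis : HilbertBasis index ℂ H
  eigenvalue : index → ℝ
  apply_basis : ∀ i, ρ (basis i) = (eigenvalue i : ℂ) • basis i

/-- `p ln(p / q) + q - p ∈ [0, ∞]` for `p, q ≥ 0`, with `0 ln 0 = 0 ln(0 / 0) = 0` and
`ln(c / 0) = ∞` for `c > 0`. -/
def relEntropyTerm (p q : ℝ) : ℝ≥0∞ :=
  if q = 0 ∧ p ≠ 0 then ⊤ else ENNReal.ofReal (p * Real.log (p / q) + q - p)

open Classical in
/-- The quantum relative entropy in bits,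
`D(ρ‖σ) = (ln 2)⁻¹ ∑ᵢⱼ |⟨φᵢ, ψⱼ⟩|² [p(i) ln(p(i) / q(j)) + q(j) - p(i)]`,
for spectral decompositions `ρ = ∑ᵢ p(i) |φᵢ⟩⟨φᵢ|` and `σ = ∑ⱼ q(j) |ψⱼ⟩⟨ψⱼ|`. Density operators
always have spectral decompositions, and the value does not depend on which ones are used. -/
def relEntropy (ρ σ : H →L[ℂ] H) : ℝ≥0∞ :=
  if h : Nonempty (SpectralDecomposition ρ) ∧ Nonempty (SpectralDecomposition σ) then
    let r := h.1.some
    let s := h.2.some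
    ENNReal.ofReal (Real.log 2)⁻¹ * ∑' (i : r.index) (j : s.index),
      ENNReal.ofReal (‖⟪r.basis i, s.basis j⟫_ℂ‖ ^ 2) *
        relEntropyTerm (r.eigenvalue i) (s.eigenvalue j)
  else ⊤

/-- The quantum mutual information `I(A;B)_ρ = D(ρ_AB ‖ ρ_A ⊗ ρ_B)` of a state `ρ` on `A ⊗ B`. -/
def stateMutualInfo (ρ : H ⊗ʰ K →L[ℂ] H ⊗ʰ K) : ℝ≥0∞ :=
  relEntropy ρ (opTensor (traceRight ρ) (traceLeft ρ))

/-- The mutual information of a positive trace-class operator,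
`I(A;B)_ω = Tr(ω) I(A;B)_{ω / Tr(ω)}` (and `0` if `Tr(ω) = 0`). -/
def mutualInfo (ω : H ⊗ʰ K →L[ℂ] H ⊗ʰ K) : ℝ≥0∞ :=
  opTrace ω * stateMutualInfo (((opTrace ω).toReal⁻¹ : ℂ) • ω)

/-- `P` is an orthogonal projection of finite rank. -/
def IsFiniteRankProjection (P : H →L[ℂ] H) : Prop :=
  IsStarProjection P ∧ FiniteDimensional ℂ P.range

/-- The conditional quantum mutual information `I(A;B|E)_ω` of a state `ω` on `(A ⊗ B) ⊗ E`:
the supremum over finite-rank projections `P` on `A` of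
`I(A;BE)_{QωQ} - I(A;E)_{QωQ}`, where `Q = P ⊗ 1_B ⊗ 1_E`. Both terms are finite for each `P`. -/
def condMutualInfo (ω : (H ⊗ʰ K) ⊗ʰ L →L[ℂ] (H ⊗ʰ K) ⊗ʰ L) : EReal :=
  ⨆ (P : H →L[ℂ] H) (_ : IsFiniteRankProjection P),
    let Q := opTensor (opTensor P (ContinuousLinearMap.id ℂ K)) (ContinuousLinearMap.id ℂ L)
    let τ := Q ∘L ω ∘L Q
    (mutualInfo (conjU (assocU H K L) τ) : EReal) - (mutualInfo (traceMid τ) : EReal)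

end Operators

/-! ### Multipartite systems -/

/-- A separable complex Hilbert space. -/
structure HilbertSystem : Type (u + 1) where
  carrier : Type u
  [normed : NormedAddCommGroup carrier]
  [inner : InnerProductSpace ℂ carrier]
  [complete : CompleteSpace carrier]
  [separable : TopologicalSpace.SeparableSpace carrier]

namespace HilbertSystem

instance : CoeSort HilbertSystem.{u} (Type u) := ⟨carrier⟩

attribute [instance] normed inner complete separable

/-- The composite system `A ⊗ B`. -/
def tensor (A B : HilbertSystem.{u}) : HilbertSystem.{u} := ⟨A ⊗ʰ B⟩

/-- The composite system `A₁ ⋯ Aₘ = (⋯ (A₁ ⊗ A₂) ⊗ ⋯) ⊗ Aₘ` of `m = n + 1` systems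
`A 0, …, A n`. -/
def compose : {n : ℕ} → (Fin (n + 1) → HilbertSystem.{u}) → HilbertSystem.{u}
  | 0, A => A 0
  | _ + 1, A => tensor (compose fun i => A i.castSucc) (A (Fin.last _))

end HilbertSystem

open HilbertSystem

/-- The conditional total correlation `I(A₁;⋯;Aₘ|E)_ρ = ∑_{i=2}^m I(Aᵢ;A₁⋯Aᵢ₋₁|E)_ρ` of a state `ρ`
on `A₁ ⋯ Aₘ ⊗ E`. The summand `i = m` is split off; the other summands only involve the marginal of
`ρ` on `A₁ ⋯ Aₘ₋₁ ⊗ E`. -/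
def condTotalCorrelation : {n : ℕ} → (A : Fin (n + 1) → HilbertSystem.{u}) →
    (E : HilbertSystem.{u}) → (compose A ⊗ʰ E →L[ℂ] compose A ⊗ʰ E) → EReal
  | 0, _, _, _ => 0
  | _ + 1, A, E, ρ =>
    let B := compose fun i => A i.castSucc
    let C := A (Fin.last _)
    condTotalCorrelation (fun i => A i.castSucc) E
        (traceMid (ρ : (B ⊗ʰ C) ⊗ʰ E →L[ℂ] (B ⊗ʰ C) ⊗ʰ E)) +
      condMutualInfo (conjU (congrU (swapU B C) E) ρ)

/-- The conditional dual total correlation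
`Ĩ(A₁;⋯;Aₘ|E)_ρ = ∑_{i=2}^m I(Aᵢ;A₁⋯Aᵢ₋₁|Aᵢ₊₁⋯AₘE)_ρ` of a state `ρ` on `A₁ ⋯ Aₘ ⊗ E`. The summand
`i = m` is split off; in the other summands `Aₘ` belongs to the conditioning system. -/
def condDualTotalCorrelation : {n : ℕ} → (A : Fin (n + 1) → HilbertSystem.{u}) →
    (E : HilbertSystem.{u}) → (compose A ⊗ʰ E →L[ℂ] compose A ⊗ʰ E) → EReal
  | 0, _, _, _ => 0
  | _ + 1, A, E, ρ =>
    let B := compose fun i => A i.castSucc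
    let C := A (Fin.last _)
    condDualTotalCorrelation (fun i => A i.castSucc) (tensor C E)
        (conjU (assocU B C E) (ρ : (B ⊗ʰ C) ⊗ʰ E →L[ℂ] (B ⊗ʰ C) ⊗ʰ E)) +
      condMutualInfo (conjU (congrU (swapU B C) E) ρ)

end QInfo

end

/-!
The theorem reduces to the duality `I(A;B|E) = I(A;B|F)` of the conditional mutual information for a
pure state of `A ⊗ B ⊗ E ⊗ F`. Given this duality, the number of systems is reduced by one at a
time: the summands of the last system `Aₘ` agree by duality, and the remaining summands form the
same two sums for the pure state of `A₁ ⋯ Aₘ₋₁ ⊗ E ⊗ (Aₘ F)`, since `Aₘ` is traced out in the total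
correlation and joins the conditioning system in the dual total correlation
(`condTotalCorrelation_eq_of_isMarginalS`).

Duality rests on `I(A;B) + I(A;C) = 2 S(A)` for a pure state of `A ⊗ B ⊗ C`, which holds in `[0, ∞]`
without any finiteness assumption (`stateMutualInfo_add_stateMutualInfo`). Let `α`, `β`, `γ` be the
eigenvalues of the reduced states on `A`, `B`, `C`, and let `w` be the joint distribution of the
outcomes of measuring the three eigenbases. By the Schmidt decomposition, the reduced states on
`A ⊗ B` and `C` have the same nonzero spectrum, and it follows that `I(A;B)` is the mean of
`log (γ / (α β))` under `w`. The negative part of this logarithm has a finite mean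
(`stateMutualInfo_add_tsum_negPart`). In the same way, `I(A;C)` is the mean of `log (β / (α γ))`,
and the two logarithms add up to `-2 log α`.

After compression with a finite-rank projection on `A`, the entropy `S(A)` is finite, so that
`I(A;BE) - I(A;E) = 2 S(A) - I(A;F) - I(A;E)`. The right-hand side is symmetric in `E` and `F`, so
the suprema that define `I(A;B|E)` and `I(A;B|F)` are equal term by term
(`condMutualInfoS_eq_of_isMarginalS`).

Reduced states of a vector `ψ ∈ H ⊗ K` are described by their matrix elements
`⟪x, ρ y⟫ = ⟪slice y ψ, slice x ψ⟫`, where `slice x ψ = (⟨x| ⊗ 1) ψ` (`IsMarginal`). In this form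
the partial traces are identified by comparing vectors on products.
-/

noncomputable section

set_option linter.unusedSectionVars false

namespace QInfo

/-! ### Product vectors and slices -/

section ProductVectors

variable {H K L : Type*}
  [NormedAddCommGroup H] [InnerProductSpace ℂ H]
  [NormedAddCommGroup K] [InnerProductSpace ℂ K]
  [NormedAddCommGroup L] [InnerProductSpace ℂ L]

theorem inner_prodVec (a c : H) (b d : K) :
    ⟪prodVec a b, prodVec c d⟫_ℂ = ⟪a, c⟫_ℂ * ⟪b, d⟫_ℂ := by
  simp [prodVec, UniformSpace.Completion.inner_coe]

theorem norm_prodVec (a : H) (b : K) : ‖prodVec a b‖ = ‖a‖ * ‖b‖ := by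
  simp [prodVec]

theorem ext_prodVec {f g : H ⊗ʰ K →L[ℂ] L} (h : ∀ x y, f (prodVec x y) = g (prodVec x y)) :
    f = g := by
  have h1 : f.toLinearMap ∘ₗ (UniformSpace.Completion.toComplL : H ⊗[ℂ] K →L[ℂ] H ⊗ʰ K).toLinearMap
      = g.toLinearMap ∘ₗ
        (UniformSpace.Completion.toComplL : H ⊗[ℂ] K →L[ℂ] H ⊗ʰ K).toLinearMap :=
    TensorProduct.ext' h
  ext z
  refine UniformSpace.Completion.induction_on z
    (isClosed_eq f.continuous g.continuous) fun t => ?_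
  exact LinearMap.congr_fun h1 t

theorem ext_inner_prodVec {u v : H ⊗ʰ K}
    (h : ∀ x y, ⟪prodVec x y, u⟫_ℂ = ⟪prodVec x y, v⟫_ℂ) : u = v := by
  have h1 : innerSL ℂ u = innerSL ℂ v := by
    refine ext_prodVec fun x y => ?_
    simp only [innerSL_apply_apply]
    rw [← inner_conj_symm, h, inner_conj_symm]
  refine ext_inner_right ℂ fun z => ?_
  simpa only [innerSL_apply_apply] using congrArg (fun f => f z) h1

theorem inner_swapU (x : H) (y : K) (ψ : H ⊗ʰ K) :
    ⟪prodVec y x, swapU H K ψ⟫_ℂ = ⟪prodVec x y, ψ⟫_ℂ := by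
  rw [← swapU_prodVec, LinearIsometryEquiv.inner_map_map]

theorem inner_assocU (x : H) (y : K) (z : L) (ψ : (H ⊗ʰ K) ⊗ʰ L) :
    ⟪prodVec x (prodVec y z), assocU H K L ψ⟫_ℂ = ⟪prodVec (prodVec x y) z, ψ⟫_ℂ := by
  rw [← assocU_prodVec, LinearIsometryEquiv.inner_map_map]

theorem inner_congrU (U : H ≃ₗᵢ[ℂ] L) (x : H) (y : K) (ψ : H ⊗ʰ K) :
    ⟪prodVec (U x) y, congrU U K ψ⟫_ℂ = ⟪prodVec x y, ψ⟫_ℂ := by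
  rw [← congrU_prodVec, LinearIsometryEquiv.inner_map_map]

/-- The unitary `(H ⊗ K) ⊗ L ≃ (H ⊗ L) ⊗ K` with `(x ⊗ y) ⊗ z ↦ (x ⊗ z) ⊗ y`. -/
def rightSwapU (H K L : Type*) [NormedAddCommGroup H] [InnerProductSpace ℂ H]
    [NormedAddCommGroup K] [InnerProductSpace ℂ K] [NormedAddCommGroup L] [InnerProductSpace ℂ L] :
    (H ⊗ʰ K) ⊗ʰ L ≃ₗᵢ[ℂ] (H ⊗ʰ L) ⊗ʰ K :=
  (swapU (H ⊗ʰ K) L).trans ((assocU L H K).symm.trans (congrU (swapU L H) K))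

theorem rightSwapU_prodVec (x : H) (y : K) (z : L) :
    rightSwapU H K L (prodVec (prodVec x y) z) = prodVec (prodVec x z) y := by
  have h : (assocU L H K).symm (prodVec z (prodVec x y)) = prodVec (prodVec z x) y := by
    rw [LinearIsometryEquiv.symm_apply_eq, assocU_prodVec]
  simp only [rightSwapU, LinearIsometryEquiv.trans_apply, swapU_prodVec, h, congrU_prodVec]

theorem inner_rightSwapU (x : H) (y : K) (z : L) (ψ : (H ⊗ʰ K) ⊗ʰ L) :
    ⟪prodVec (prodVec x z) y, rightSwapU H K L ψ⟫_ℂ = ⟪prodVec (prodVec x y) z, ψ⟫_ℂ := by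
  rw [← rightSwapU_prodVec, LinearIsometryEquiv.inner_map_map]

/-- Two functionals of the form `z ↦ ⟪T z, u⟫` agree if they agree on product vectors. All
identities between regroupings of tensor factors are checked in this way, one factor at a time. -/
theorem inner_prodVec_eq_of_forall {G : Type*} [NormedAddCommGroup G] [InnerProductSpace ℂ G]
    {T : H ⊗ʰ K →L[ℂ] L} {S : H ⊗ʰ K →L[ℂ] G} {u : L} {v : G}
    (h : ∀ x y, ⟪T (prodVec x y), u⟫_ℂ = ⟪S (prodVec x y), v⟫_ℂ) (z : H ⊗ʰ K) :
    ⟪T z, u⟫_ℂ = ⟪S z, v⟫_ℂ := by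
  have h1 : (innerSL ℂ u) ∘L T = (innerSL ℂ v) ∘L S := by
    refine ext_prodVec fun x y => ?_
    simp only [ContinuousLinearMap.comp_apply, innerSL_apply_apply]
    rw [← inner_conj_symm, h, inner_conj_symm]
  have h2 := congrArg (fun f => f z) h1
  simp only [ContinuousLinearMap.comp_apply, innerSL_apply_apply] at h2
  rw [← inner_conj_symm, h2, inner_conj_symm]

end ProductVectors

section Slices

variable {H K : Type*}
  [NormedAddCommGroup H] [InnerProductSpace ℂ H] [CompleteSpace H]
  [NormedAddCommGroup K] [InnerProductSpace ℂ K] [CompleteSpace K]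

/-- The partial inner product `(⟨x| ⊗ 1) ψ ∈ K` of a vector `ψ ∈ H ⊗ K` with `x ∈ H`. -/
def slice (x : H) (ψ : H ⊗ʰ K) : K := (insertLeft K x).adjoint ψ

theorem inner_slice (x : H) (z : K) (ψ : H ⊗ʰ K) :
    ⟪z, slice x ψ⟫_ℂ = ⟪prodVec x z, ψ⟫_ℂ := by
  rw [slice, ContinuousLinearMap.adjoint_inner_right, insertLeft_apply]

theorem inner_slice_left (x : H) (z : K) (ψ : H ⊗ʰ K) :
    ⟪slice x ψ, z⟫_ℂ = ⟪ψ, prodVec x z⟫_ℂ := by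
  rw [← inner_conj_symm, inner_slice, inner_conj_symm]

theorem inner_slice_swapU (x : H) (z : K) (ψ : H ⊗ʰ K) :
    ⟪x, slice z (swapU H K ψ)⟫_ℂ = ⟪z, slice x ψ⟫_ℂ := by
  rw [inner_slice, inner_swapU, inner_slice]

theorem prodVec_sub_left (x y : H) (z : K) : prodVec (x - y) z = prodVec x z - prodVec y z := by
  simp only [← insertRight_apply, map_sub]

theorem slice_smul_left (c : ℂ) (x : H) (ψ : H ⊗ʰ K) :
    slice (c • x) ψ = (starRingEnd ℂ) c • slice x ψ := by
  refine ext_inner_left ℂ fun z => ?_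
  rw [inner_smul_right, inner_slice, inner_slice, ← insertRight_apply, ← insertRight_apply,
    map_smul, inner_smul_left]

theorem slice_smul_right (c : ℂ) (x : H) (ψ : H ⊗ʰ K) : slice x (c • ψ) = c • slice x ψ :=
  map_smul _ _ _

theorem norm_slice_le (x : H) (ψ : H ⊗ʰ K) : ‖slice x ψ‖ ≤ ‖x‖ * ‖ψ‖ := by
  refine ((insertLeft K x).adjoint.le_opNorm ψ).trans ?_
  gcongr
  rw [LinearIsometryEquiv.norm_map]
  refine ContinuousLinearMap.opNorm_le_bound _ (norm_nonneg _) fun y => ?_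
  rw [insertLeft_apply, norm_prodVec]

variable {ι κ : Type*}

theorem tsum_norm_inner_sq (b : HilbertBasis ι ℂ H) (x : H) :
    ∑' i, ENNReal.ofReal (‖⟪b i, x⟫_ℂ‖ ^ 2) = ENNReal.ofReal (‖x‖ ^ 2) := by
  have h := b.hasSum_inner_mul_inner x x
  have e : ∀ i, ⟪x, b i⟫_ℂ * ⟪b i, x⟫_ℂ = ((‖⟪b i, x⟫_ℂ‖ ^ 2 : ℝ) : ℂ) := fun i => by
    rw [← inner_conj_symm, RCLike.conj_mul]; norm_cast
  simp only [e, inner_self_eq_norm_sq_to_K] at h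
  have h' : HasSum (fun i => ‖⟪b i, x⟫_ℂ‖ ^ 2) (‖x‖ ^ 2) := by
    rw [← Complex.hasSum_ofReal]
    simpa using h
  rw [← h'.tsum_eq, ENNReal.ofReal_tsum_of_nonneg (fun _ => by positivity) h'.summable]

/-- The product basis of `H ⊗ K`. -/
def prodBasis (b : HilbertBasis ι ℂ H) (c : HilbertBasis κ ℂ K) :
    HilbertBasis (ι × κ) ℂ (H ⊗ʰ K) :=
  HilbertBasis.mkOfOrthogonalEqBot (v := fun p : ι × κ => prodVec (b p.1) (c p.2))
    (by
      classical
      rw [orthonormal_iff_ite]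
      rintro ⟨i, k⟩ ⟨j, l⟩
      rw [inner_prodVec, orthonormal_iff_ite.mp b.orthonormal, orthonormal_iff_ite.mp c.orthonormal]
      by_cases h1 : i = j <;> by_cases h2 : k = l <;> simp [h1, h2])
    (by
      rw [Submodule.eq_bot_iff]
      intro u hu
      have h0 : ∀ i k, ⟪prodVec (b i) (c k), u⟫_ℂ = 0 := fun i k =>
        (Submodule.mem_orthogonal _ _).mp hu _ (Submodule.subset_span ⟨(i, k), rfl⟩)
      have h1 : ∀ i, slice (b i) u = 0 := fun i => by
        refine c.repr.injective (lp.ext (funext fun k => ?_))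
        rw [c.repr_apply_apply, inner_slice, h0]
        simp
      have h2 : ∀ y, slice y (swapU H K u) = 0 := fun y => by
        refine b.repr.injective (lp.ext (funext fun k => ?_))
        rw [b.repr_apply_apply, inner_slice_swapU, h1]
        simp
      refine ext_inner_prodVec fun x y => ?_
      rw [← inner_slice, ← inner_slice_swapU, h2]
      simp)

theorem prodBasis_apply (b : HilbertBasis ι ℂ H) (c : HilbertBasis κ ℂ K) (p : ι × κ) :
    prodBasis b c p = prodVec (b p.1) (c p.2) := by
  rw [prodBasis, HilbertBasis.coe_mkOfOrthogonalEqBot]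

theorem hasSum_inner_slice (b : HilbertBasis ι ℂ H) (u v : H ⊗ʰ K) :
    HasSum (fun i => ⟪slice (b i) u, slice (b i) v⟫_ℂ) ⟪u, v⟫_ℂ := by
  obtain ⟨w, c, -⟩ := exists_hilbertBasis ℂ K
  have h := (prodBasis b c).hasSum_inner_mul_inner u v
  refine h.prod_fiberwise fun i => ?_
  have h2 := c.hasSum_inner_mul_inner (slice (b i) u) (slice (b i) v)
  simpa only [prodBasis_apply, inner_slice, inner_slice_left] using h2

theorem hasSum_norm_slice_sq (b : HilbertBasis ι ℂ H) (u : H ⊗ʰ K) :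
    HasSum (fun i => ‖slice (b i) u‖ ^ 2) (‖u‖ ^ 2) := by
  rw [← Complex.hasSum_ofReal]
  simpa [inner_self_eq_norm_sq_to_K] using hasSum_inner_slice b u u

end Slices

/-! ### Reduced operators of vectors -/

section Marginals

variable {H K L M : Type*}
  [NormedAddCommGroup H] [InnerProductSpace ℂ H] [CompleteSpace H]
  [NormedAddCommGroup K] [InnerProductSpace ℂ K] [CompleteSpace K]
  [NormedAddCommGroup L] [InnerProductSpace ℂ L] [CompleteSpace L]
  [NormedAddCommGroup M] [InnerProductSpace ℂ M] [CompleteSpace M]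
variable {ι : Type*}

/-- `ρ` is the reduced operator `Tr_K |ψ⟩⟨ψ|` on `H` of a (not necessarily normalised) vector
`ψ ∈ H ⊗ K`. Its matrix elements are written without a basis of `K`, as inner products of slices. -/
def IsMarginal (ψ : H ⊗ʰ K) (ρ : H →L[ℂ] H) : Prop :=
  ∀ x y, ⟪x, ρ y⟫_ℂ = ⟪slice y ψ, slice x ψ⟫_ℂ

theorem IsMarginal.unique {ψ : H ⊗ʰ K} {ρ σ : H →L[ℂ] H} (hρ : IsMarginal ψ ρ)
    (hσ : IsMarginal ψ σ) : ρ = σ := by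
  ext y
  exact ext_inner_left ℂ fun x => by rw [hρ, hσ]

/-- The criterion behind all partial traces: the sum of the operators `(V eₖ)† ρ (V eₖ)` converges
in norm, because the `k`-th term is bounded by a summable `c k`, and its matrix elements are
computed by a resolution of the identity `∑ₖ sₖ† sₖ = 1`. -/
theorem isMarginal_traceAlong_of_forall {G : Type*} [NormedAddCommGroup G] [InnerProductSpace ℂ G]
    [CompleteSpace G] {V : K → (H →L[ℂ] L)} {ρ : L →L[ℂ] L} {J : L → M}
    (hρ : ∀ x y, ⟪x, ρ y⟫_ℂ = ⟪J y, J x⟫_ℂ) {ψ' : H ⊗ʰ G} {s : K → G → M}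
    (hs : ∀ u v, HasSum (fun k => ⟪s (onb K k) u, s (onb K k) v⟫_ℂ) ⟪u, v⟫_ℂ)
    (hJ : ∀ k x, J (V k x) = s k (slice x ψ'))
    {c : onbIndex K → ℝ} (hc : Summable c) (hc0 : ∀ k, 0 ≤ c k)
    (hb : ∀ k x, ‖s (onb K k) (slice x ψ')‖ ^ 2 ≤ c k * ‖x‖ ^ 2) :
    Summable (fun k => (V (onb K k)).adjoint ∘L ρ ∘L V (onb K k)) ∧
      IsMarginal ψ' (traceAlong V ρ) := by
  set W : onbIndex K → (H →L[ℂ] H) := fun k => (V (onb K k)).adjoint ∘L ρ ∘L V (onb K k) with hW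
  have hel : ∀ k x y, ⟪x, W k y⟫_ℂ =
      ⟪s (onb K k) (slice y ψ'), s (onb K k) (slice x ψ')⟫_ℂ := fun k x y => by
    simp only [hW, ContinuousLinearMap.comp_apply, ContinuousLinearMap.adjoint_inner_right]
    rw [hρ, hJ, hJ]
  have hb' : ∀ k x, ‖s (onb K k) (slice x ψ')‖ ≤ √(c k) * ‖x‖ := fun k x => by
    refine le_of_sq_le_sq ?_ (by positivity)
    rw [mul_pow, Real.sq_sqrt (hc0 k)]
    exact hb k x
  have hnorm : ∀ k, ‖W k‖ ≤ c k := fun k => by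
    refine ContinuousLinearMap.opNorm_le_bound _ (hc0 k) fun y => ?_
    rcases (norm_nonneg (W k y)).eq_or_lt with h0 | h0
    · rw [← h0]; exact mul_nonneg (hc0 k) (norm_nonneg _)
    have h1 : ‖W k y‖ * ‖W k y‖ ≤ ‖W k y‖ * (c k * ‖y‖) := by
      calc ‖W k y‖ * ‖W k y‖ = ‖⟪W k y, W k y⟫_ℂ‖ := by
            rw [inner_self_eq_norm_sq_to_K, norm_pow, RCLike.norm_ofReal, abs_norm, sq]
        _ ≤ ‖s (onb K k) (slice y ψ')‖ * ‖s (onb K k) (slice (W k y) ψ')‖ := by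
            rw [hel]; exact norm_inner_le_norm _ _
        _ ≤ (√(c k) * ‖y‖) * (√(c k) * ‖W k y‖) :=
            mul_le_mul (hb' k _) (hb' k _) (norm_nonneg _) (by positivity)
        _ = (√(c k) * √(c k)) * (‖y‖ * ‖W k y‖) := by ring
        _ = ‖W k y‖ * (c k * ‖y‖) := by rw [Real.mul_self_sqrt (hc0 k)]; ring
    exact le_of_mul_le_mul_left h1 h0
  have hsum : Summable W := Summable.of_norm_bounded hc hnorm
  refine ⟨hsum, fun x y => ?_⟩
  have h1 : HasSum (fun k => ⟪x, W k y⟫_ℂ) ⟪x, traceAlong V ρ y⟫_ℂ :=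
    (hsum.hasSum.mapL ((innerSL ℂ x) ∘L (ContinuousLinearMap.apply ℂ H y)))
  refine h1.unique ?_
  simp only [hel]
  exact hs _ _

/-- The partial trace of a pure state is the reduced operator of its vector. -/
theorem isMarginal_traceAlong_rankOne {V : K → (H →L[ℂ] L)} {ψ : L} {ψ' : H ⊗ʰ K}
    (h : ∀ x k, ⟪V k x, ψ⟫_ℂ = ⟪prodVec x k, ψ'⟫_ℂ) :
    Summable (fun k => (V (onb K k)).adjoint ∘L InnerProductSpace.rankOne ℂ ψ ψ ∘L V (onb K k)) ∧
      IsMarginal ψ' (traceAlong V (InnerProductSpace.rankOne ℂ ψ ψ)) := by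
  refine isMarginal_traceAlong_of_forall (M := ℂ) (J := fun x => ⟪x, ψ⟫_ℂ) (s := fun k u => ⟪k, u⟫_ℂ)
    (c := fun k => ‖slice (onb K k) (swapU H K ψ')‖ ^ 2) ?_ ?_ ?_
    (hasSum_norm_slice_sq _ _).summable (fun _ => sq_nonneg _) ?_
  · intro x y
    rw [InnerProductSpace.rankOne_apply, inner_smul_right, RCLike.inner_apply, inner_conj_symm,
      mul_comm]
  · intro u v
    simp only [RCLike.inner_apply, inner_conj_symm]
    simpa only [mul_comm] using (onb K).hasSum_inner_mul_inner u v
  · intro k x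
    rw [h, inner_slice]
  · intro k x
    rw [← inner_slice_swapU, ← mul_pow, mul_comm ‖slice _ _‖]
    gcongr
    exact norm_inner_le_norm _ _

/-- The partial trace of the reduced operator of a vector is again the reduced operator of this
vector, the traced-out system having moved to the complement. -/
theorem IsMarginal.traceAlong {V : K → (H →L[ℂ] L)} {ρ : L →L[ℂ] L} {ψ : L ⊗ʰ M}
    {ψ' : H ⊗ʰ (K ⊗ʰ M)} (hρ : IsMarginal ψ ρ)
    (h : ∀ x k m, ⟪prodVec (V k x) m, ψ⟫_ℂ = ⟪prodVec x (prodVec k m), ψ'⟫_ℂ) :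
    IsMarginal ψ' (traceAlong V ρ) := by
  -- `χ` is `ψ'` with its factors rearranged as `K ⊗ (H ⊗ M)`.
  set χ : K ⊗ʰ (H ⊗ʰ M) := assocU K H M (congrU (swapU H K) M ((assocU H K M).symm ψ')) with hχ
  have hχ' : ∀ x k, slice k (slice x ψ') = slice x (slice k χ) := fun x k => by
    refine ext_inner_left ℂ fun m => ?_
    rw [inner_slice, inner_slice, inner_slice, inner_slice, hχ, inner_assocU, ← swapU_prodVec x k,
      inner_congrU, ← assocU_prodVec, ← LinearIsometryEquiv.inner_map_map (assocU H K M)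
        (prodVec (prodVec x k) m), LinearIsometryEquiv.apply_symm_apply]
  refine (isMarginal_traceAlong_of_forall (J := fun x => slice x ψ) (s := fun k u => slice k u)
    (c := fun k => ‖slice (onb K k) χ‖ ^ 2) hρ (hasSum_inner_slice (onb K)) ?_
    (hasSum_norm_slice_sq _ _).summable (fun _ => sq_nonneg _) ?_).2
  · intro k x
    refine ext_inner_left ℂ fun m => ?_
    rw [inner_slice, inner_slice, inner_slice, h]
  · intro k x
    rw [hχ', ← mul_pow, mul_comm ‖slice _ χ‖]
    gcongr
    exact norm_slice_le _ _

theorem isMarginal_traceRight_rankOne (ψ : H ⊗ʰ K) :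
    IsMarginal ψ (traceRight (InnerProductSpace.rankOne ℂ ψ ψ)) :=
  (isMarginal_traceAlong_rankOne fun _ _ => rfl).2

theorem isMarginal_traceMid_rankOne (ψ : (H ⊗ʰ K) ⊗ʰ L) :
    IsMarginal (rightSwapU H K L ψ) (traceMid (InnerProductSpace.rankOne ℂ ψ ψ)) := by
  refine (isMarginal_traceAlong_rankOne fun x k => ?_).2
  rw [← insertRight_apply (H := H ⊗ʰ L) k x]
  refine inner_prodVec_eq_of_forall (fun h l => ?_) x
  rw [insertRight_apply, inner_rightSwapU, opTensor_prodVec]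
  rfl

theorem IsMarginal.traceRight {ψ : (H ⊗ʰ K) ⊗ʰ M} {ρ : H ⊗ʰ K →L[ℂ] H ⊗ʰ K}
    (hρ : IsMarginal ψ ρ) : IsMarginal (assocU H K M ψ) (traceRight ρ) :=
  hρ.traceAlong fun x k m => by rw [inner_assocU, insertRight_apply]

theorem IsMarginal.traceLeft {ψ : (H ⊗ʰ K) ⊗ʰ M} {ρ : H ⊗ʰ K →L[ℂ] H ⊗ʰ K}
    (hρ : IsMarginal ψ ρ) :
    IsMarginal (assocU K H M (congrU (swapU H K) M ψ)) (traceLeft ρ) :=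
  hρ.traceAlong fun x k m => by
    rw [inner_assocU, insertLeft_apply, ← swapU_prodVec k x, inner_congrU]

theorem slice_congrU (U : H ≃ₗᵢ[ℂ] L) (x : L) (ψ : H ⊗ʰ M) :
    slice x (congrU U M ψ) = slice (U.symm x) ψ := by
  refine ext_inner_left ℂ fun z => ?_
  rw [inner_slice, inner_slice, ← inner_congrU U, LinearIsometryEquiv.apply_symm_apply]

theorem IsMarginal.conjU {ψ : H ⊗ʰ M} {ρ : H →L[ℂ] H} (hρ : IsMarginal ψ ρ) (U : H ≃ₗᵢ[ℂ] L) :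
    IsMarginal (congrU U M ψ) (conjU U ρ) := fun x y => by
  rw [slice_congrU, slice_congrU, ← hρ, ← U.inner_map_map (U.symm x),
    LinearIsometryEquiv.apply_symm_apply]
  rfl

theorem adjoint_opTensor (f : H →L[ℂ] L) (g : K →L[ℂ] M) :
    (opTensor f g).adjoint = opTensor f.adjoint g.adjoint := by
  refine ext_prodVec fun x y => ?_
  refine ext_inner_prodVec fun z w => ?_
  rw [ContinuousLinearMap.adjoint_inner_right, opTensor_prodVec, opTensor_prodVec, inner_prodVec,
    inner_prodVec, ContinuousLinearMap.adjoint_inner_right, ContinuousLinearMap.adjoint_inner_right]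

theorem inner_opTensor (f : H →L[ℂ] L) (g : K →L[ℂ] M) (x : L) (y : M) (ψ : H ⊗ʰ K) :
    ⟪prodVec x y, opTensor f g ψ⟫_ℂ = ⟪prodVec (f.adjoint x) (g.adjoint y), ψ⟫_ℂ := by
  rw [← ContinuousLinearMap.adjoint_inner_left, adjoint_opTensor, opTensor_prodVec]

theorem IsMarginal.conj {ψ : H ⊗ʰ M} {ρ : H →L[ℂ] H} (hρ : IsMarginal ψ ρ) {Q : H →L[ℂ] H}
    (hQ : Q.adjoint = Q) :
    IsMarginal (opTensor Q (ContinuousLinearMap.id ℂ M) ψ) (Q ∘L ρ ∘L Q) := fun x y => by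
  have h : ∀ x, slice x (opTensor Q (ContinuousLinearMap.id ℂ M) ψ) = slice (Q x) ψ := fun x => by
    refine ext_inner_left ℂ fun z => ?_
    rw [inner_slice, inner_slice, inner_opTensor, hQ, ContinuousLinearMap.adjoint_id]
    rfl
  rw [h, h, ← hρ, ContinuousLinearMap.comp_apply, ContinuousLinearMap.comp_apply,
    ← ContinuousLinearMap.adjoint_inner_left, hQ]

theorem IsMarginal.smul {ψ : H ⊗ʰ M} {ρ : H →L[ℂ] H} (hρ : IsMarginal ψ ρ) (c : ℝ) :
    IsMarginal ((c : ℂ) • ψ) (((c ^ 2 : ℝ) : ℂ) • ρ) := fun x y => by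
  rw [slice_smul_right, slice_smul_right, inner_smul_left, inner_smul_right, ← hρ,
    smul_apply, inner_smul_right, Complex.conj_ofReal]
  push_cast
  ring

theorem IsMarginal.inner_self {ψ : H ⊗ʰ M} {ρ : H →L[ℂ] H} (hρ : IsMarginal ψ ρ) (x : H) :
    ⟪x, ρ x⟫_ℂ = ((‖slice x ψ‖ ^ 2 : ℝ) : ℂ) := by
  rw [hρ, inner_self_eq_norm_sq_to_K]
  norm_cast

theorem tsum_norm_slice_sq (b : HilbertBasis ι ℂ H) (ψ : H ⊗ʰ K) :
    ∑' i, ENNReal.ofReal (‖slice (b i) ψ‖ ^ 2) = ENNReal.ofReal (‖ψ‖ ^ 2) := by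
  have h := hasSum_norm_slice_sq b ψ
  rw [← h.tsum_eq, ENNReal.ofReal_tsum_of_nonneg (fun _ => by positivity) h.summable]

theorem IsMarginal.opTrace {ψ : H ⊗ʰ M} {ρ : H →L[ℂ] H} (hρ : IsMarginal ψ ρ) :
    opTrace ρ = ENNReal.ofReal (‖ψ‖ ^ 2) := by
  simp only [QInfo.opTrace, hρ.inner_self, Complex.ofReal_re, tsum_norm_slice_sq]

theorem IsMarginal.isSymmetric {ψ : H ⊗ʰ M} {ρ : H →L[ℂ] H} (hρ : IsMarginal ψ ρ) :
    (ρ : H →ₗ[ℂ] H).IsSymmetric := fun x y => by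
  simp only [ContinuousLinearMap.coe_coe]
  rw [hρ, ← inner_conj_symm, hρ, inner_conj_symm]

theorem IsMarginal.isCompactOperator {ψ : H ⊗ʰ M} {ρ : H →L[ℂ] H} (hρ : IsMarginal ψ ρ) :
    IsCompactOperator ρ := by
  obtain ⟨hs, hm⟩ := isMarginal_traceAlong_rankOne (V := fun k : M => insertRight H k) (ψ := ψ)
    (ψ' := ψ) (fun _ _ => rfl)
  rw [hρ.unique hm]
  refine isCompactOperator_of_tendsto hs.hasSum (Filter.Eventually.of_forall fun s => ?_)
  refine Submodule.sum_mem (compactOperator (RingHom.id ℂ) H H) fun k _ => ?_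
  have h : IsCompactOperator (InnerProductSpace.rankOne ℂ ψ ψ) := by
    have e : InnerProductSpace.rankOne ℂ ψ ψ =
      (ContinuousLinearMap.toSpanSingleton ℂ ψ) ∘L (innerSL ℂ ψ) := by
      ext x; simp
    rw [e]
    exact (isCompactOperator_of_locallyCompactSpace_dom (innerSL ℂ ψ)).clm_comp
      (ContinuousLinearMap.toSpanSingleton ℂ ψ)
  exact (h.comp_clm (insertRight H (onb M k))).clm_comp (insertRight H (onb M k)).adjoint

end Marginals

/-! ### Spectral decompositions -/

section Spectral

variable {H K : Type*}
  [NormedAddCommGroup H] [InnerProductSpace ℂ H] [CompleteSpace H]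
  [NormedAddCommGroup K] [InnerProductSpace ℂ K] [CompleteSpace K]
variable {ι κ : Type*}

theorem exists_spectralDecomposition {T : H →L[ℂ] H} (hT : IsCompactOperator T)
    (hT' : (T : H →ₗ[ℂ] H).IsSymmetric) : Nonempty (SpectralDecomposition T) := by
  classical
  let V : ℂ → Submodule ℂ H := fun μ => Module.End.eigenspace (T : Module.End ℂ H) μ
  have hV : ∀ μ, CompleteSpace (V μ) := fun μ => by
    have e : V μ = (T - μ • ContinuousLinearMap.id ℂ H).ker := by
      ext x
      simp [V, sub_eq_zero]
    rw [e]
    exact (ContinuousLinearMap.isClosed_ker _).completeSpace_coe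
  choose w b hb using fun μ => exists_hilbertBasis ℂ (V μ)
  have ho : Orthonormal ℂ (fun a : Σ μ, w μ => ((b a.1 a.2 : V a.1) : H)) :=
    hT'.orthogonalFamily_eigenspaces.orthonormal_sigma_orthonormal fun μ => (b μ).orthonormal
  have hd : (Submodule.span ℂ (Set.range fun a : Σ μ, w μ => ((b a.1 a.2 : V a.1) : H)))ᗮ = ⊥ := by
    rw [eq_bot_iff, ← ContinuousLinearMap.orthogonalComplement_iSup_eigenspaces_eq_bot hT hT',
      ← Submodule.iInf_orthogonal]
    refine le_iInf fun μ x hx => ?_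
    rw [Submodule.mem_orthogonal]
    intro v hv
    have h1 : (V μ).starProjection x = 0 := by
      have h2 : (V μ).orthogonalProjectionOnto x = 0 := by
        refine (b μ).repr.injective (lp.ext (funext fun k => ?_))
        rw [(b μ).repr_apply_apply, Submodule.inner_orthogonalProjectionOnto_eq_of_mem_left]
        rw [(Submodule.mem_orthogonal _ _).mp hx _ (Submodule.subset_span ⟨⟨μ, k⟩, rfl⟩)]
        simp
      rw [Submodule.starProjection_apply, h2]; rfl
    rw [Submodule.starProjection_apply_eq_zero_iff] at h1
    exact (Submodule.mem_orthogonal _ _).mp h1 v hv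
  -- The index type has to be a set of vectors.
  have hr : Orthonormal ℂ ((↑) : Set.range (fun a : Σ μ, w μ => ((b a.1 a.2 : V a.1) : H)) → H) :=
    ho.toSubtypeRange
  have hp : ∀ i : Set.range (fun a : Σ μ, w μ => ((b a.1 a.2 : V a.1) : H)), ∃ p : ℝ,
      T i = (p : ℂ) • (i : H) := by
    rintro ⟨_, ⟨⟨μ, k⟩, rfl⟩⟩
    have h1 : T ((b μ k : V μ) : H) = μ • ((b μ k : V μ) : H) :=
      Module.End.mem_eigenspace_iff.mp (b μ k).2
    have h2 : (starRingEnd ℂ) μ = μ := by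
      refine hT'.conj_eigenvalue_eq_self (Module.End.hasEigenvalue_of_hasEigenvector
        ⟨(b μ k).2, fun h => ?_⟩)
      have := (b μ).orthonormal.ne_zero k
      exact this (Subtype.ext h)
    refine ⟨μ.re, ?_⟩
    rw [Complex.conj_eq_iff_re.mp h2]
    exact h1
  choose p hp using hp
  exact ⟨⟨_, HilbertBasis.mkOfOrthogonalEqBot hr (by rw [Subtype.range_coe]; exact hd), p,
    fun i => by
      rw [HilbertBasis.coe_mkOfOrthogonalEqBot]; exact hp i⟩⟩

theorem spectralDecomposition_of_basis {T : H →L[ℂ] H} (b : HilbertBasis ι ℂ H) {p : ι → ℝ}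
    (hb : ∀ i, T (b i) = (p i : ℂ) • b i) : Nonempty (SpectralDecomposition T) := by
  have hp : ∀ i : Set.range b, ∃ p : ℝ, T i = (p : ℂ) • (i : H) := by
    rintro ⟨_, ⟨i, rfl⟩⟩
    exact ⟨p i, hb i⟩
  choose q hq using hp
  exact ⟨⟨_, HilbertBasis.mk b.orthonormal.toSubtypeRange (by
    rw [Subtype.range_coe, b.dense_span]), q, fun i => by
    rw [HilbertBasis.coe_mk]; exact hq i⟩⟩

/-- The eigenspace of `T` for a real number `q`. -/
def eigSpace (T : H →L[ℂ] H) (q : ℝ) : Submodule ℂ H :=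
  (T - (q : ℂ) • ContinuousLinearMap.id ℂ H).ker

theorem mem_eigSpace {T : H →L[ℂ] H} {q : ℝ} {x : H} : x ∈ eigSpace T q ↔ T x = (q : ℂ) • x := by
  simp [eigSpace, sub_eq_zero]

instance (T : H →L[ℂ] H) (q : ℝ) : CompleteSpace (eigSpace T q) :=
  (ContinuousLinearMap.isClosed_ker _).completeSpace_coe

theorem inner_apply_of_eigenbasis {T : H →L[ℂ] H} (b : HilbertBasis ι ℂ H) {p : ι → ℝ}
    (hb : ∀ i, T (b i) = (p i : ℂ) • b i) (i : ι) (x : H) :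
    ⟪b i, T x⟫_ℂ = p i * ⟪b i, x⟫_ℂ := by
  classical
  have h1 := (b.hasSum_repr x).mapL ((innerSL ℂ (b i)) ∘L T)
  have h2 := (b.hasSum_repr x).mapL ((p i : ℂ) • innerSL ℂ (b i))
  have e : (fun j => ((innerSL ℂ (b i)) ∘L T) (b.repr x j • b j)) =
      fun j => ((p i : ℂ) • innerSL ℂ (b i)) (b.repr x j • b j) := by
    funext j
    simp only [ContinuousLinearMap.comp_apply, map_smul, hb, smul_apply,
      innerSL_apply_apply, orthonormal_iff_ite.mp b.orthonormal]
    by_cases h : i = j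
    · subst h; simp
    · simp [h]
  rw [e] at h1
  simpa using h1.unique h2

/-- For an eigenbasis `(bᵢ)` of `T`, the weights `|⟨bᵢ, x⟩|²` belonging to one eigenvalue add up to
the squared norm of the projection of `x` to the eigenspace, so that `⟨x, g(T) x⟩` does not depend
on the eigenbasis. -/
theorem tsum_eigenbasis {T : H →L[ℂ] H} (b : HilbertBasis ι ℂ H) {p : ι → ℝ}
    (hb : ∀ i, T (b i) = (p i : ℂ) • b i) (g : ℝ → ℝ≥0∞) (x : H) :
    ∑' i, ENNReal.ofReal (‖⟪b i, x⟫_ℂ‖ ^ 2) * g (p i) =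
      ∑' q : ℝ, g q * ENNReal.ofReal (‖(eigSpace T q).starProjection x‖ ^ 2) := by
  classical
  have hproj : ∀ (q : ℝ) (i : ι), ⟪b i, (eigSpace T q).starProjection x⟫_ℂ =
      if p i = q then ⟪b i, x⟫_ℂ else 0 := fun q i => by
    split_ifs with h
    · subst h
      rw [← Submodule.inner_starProjection_left_eq_right,
        Submodule.starProjection_eq_self_iff.mpr (mem_eigSpace.mpr (hb i))]
    · have h1 : T ((eigSpace T q).starProjection x) = (q : ℂ) • (eigSpace T q).starProjection x :=
        mem_eigSpace.mp (Submodule.starProjection_apply_mem _ x)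
      have h2 := inner_apply_of_eigenbasis b hb i ((eigSpace T q).starProjection x)
      rw [h1, inner_smul_right] at h2
      by_contra h3
      exact h (by exact_mod_cast (mul_right_cancel₀ h3 h2).symm)
  have h1 : ∀ q : ℝ, g q * ENNReal.ofReal (‖(eigSpace T q).starProjection x‖ ^ 2) =
      ∑' i, if q = p i then ENNReal.ofReal (‖⟪b i, x⟫_ℂ‖ ^ 2) * g (p i) else 0 := fun q => by
    rw [← tsum_norm_inner_sq b, ← ENNReal.tsum_mul_left]
    refine tsum_congr fun i => ?_
    rw [hproj]
    by_cases h : p i = q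
    · subst h; simp [mul_comm]
    · simp [h, Ne.symm h]
  simp only [h1]
  rw [ENNReal.tsum_comm]
  refine tsum_congr fun i => ?_
  rw [tsum_ite_eq]

/-- The relative entropy may be computed with any two eigenbases. -/
theorem relEntropy_eq {ρ σ : H →L[ℂ] H} (b : HilbertBasis ι ℂ H) {p : ι → ℝ}
    (hb : ∀ i, ρ (b i) = (p i : ℂ) • b i) (c : HilbertBasis κ ℂ H) {q : κ → ℝ}
    (hc : ∀ j, σ (c j) = (q j : ℂ) • c j) :
    relEntropy ρ σ = ENNReal.ofReal (Real.log 2)⁻¹ * ∑' (j : κ) (i : ι),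
      ENNReal.ofReal (‖⟪b i, c j⟫_ℂ‖ ^ 2) * relEntropyTerm (p i) (q j) := by
  have h : Nonempty (SpectralDecomposition ρ) ∧ Nonempty (SpectralDecomposition σ) :=
    ⟨spectralDecomposition_of_basis b hb, spectralDecomposition_of_basis c hc⟩
  rw [relEntropy, dif_pos h]
  dsimp only
  congr 1
  set r := h.1.some
  set s := h.2.some
  calc _ = ∑' (i : r.index) (j : κ), ENNReal.ofReal (‖⟪r.basis i, c j⟫_ℂ‖ ^ 2) *
        relEntropyTerm (r.eigenvalue i) (q j) := by
        refine tsum_congr fun i => ?_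
        simp only [norm_inner_symm (r.basis i)]
        rw [tsum_eigenbasis s.basis s.apply_basis (relEntropyTerm (r.eigenvalue i)),
          tsum_eigenbasis c hc (relEntropyTerm (r.eigenvalue i))]
    _ = _ := by
        rw [ENNReal.tsum_comm]
        refine tsum_congr fun j => ?_
        rw [tsum_eigenbasis r.basis r.apply_basis (fun t => relEntropyTerm t (q j)),
          tsum_eigenbasis b hb (fun t => relEntropyTerm t (q j))]

theorem IsMarginal.exists_spectralDecomposition {ψ : H ⊗ʰ K} {ρ : H →L[ℂ] H}
    (hρ : IsMarginal ψ ρ) : Nonempty (SpectralDecomposition ρ) :=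
  QInfo.exists_spectralDecomposition hρ.isCompactOperator hρ.isSymmetric

/-- A form of the Schmidt decomposition: `y ↦ ⟨y|ψ⟩` intertwines the two reduced operators. -/
theorem IsMarginal.apply_slice {ψ : H ⊗ʰ K} {ρ : H →L[ℂ] H} {σ : K →L[ℂ] K}
    (hρ : IsMarginal ψ ρ) (hσ : IsMarginal (swapU H K ψ) σ) (x : H) :
    σ (slice x ψ) = slice (ρ x) ψ := by
  refine ext_inner_left ℂ fun z => ?_
  rw [hσ, ← inner_conj_symm, inner_slice_swapU, ← inner_slice_swapU (ρ x), ← inner_conj_symm (ρ x),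
    hρ]

theorem slice_mem_eigSpace {ψ : H ⊗ʰ K} {ρ : H →L[ℂ] H} {σ : K →L[ℂ] K}
    (hρ : IsMarginal ψ ρ) (hσ : IsMarginal (swapU H K ψ) σ) {q : ℝ} {x : H}
    (hx : x ∈ eigSpace ρ q) : slice x ψ ∈ eigSpace σ q := by
  rw [mem_eigSpace] at hx ⊢
  rw [hρ.apply_slice hσ, hx, slice_smul_left, Complex.conj_ofReal]

theorem swapU_swapU (ψ : H ⊗ʰ K) : swapU K H (swapU H K ψ) = ψ :=
  ext_inner_prodVec fun x y => by rw [inner_swapU, inner_swapU]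

/-- The eigenprojections of the two reduced operators of `ψ` are matched by `y ↦ ⟨y|ψ⟩`. -/
theorem norm_starProjection_slice_sq {ψ : H ⊗ʰ K} {ρ : H →L[ℂ] H} {σ : K →L[ℂ] K}
    (hρ : IsMarginal ψ ρ) (hσ : IsMarginal (swapU H K ψ) σ) (q : ℝ) (y : H) :
    ‖(eigSpace σ q).starProjection (slice y ψ)‖ ^ 2 =
      q * ‖(eigSpace ρ q).starProjection y‖ ^ 2 := by
  set u := (eigSpace ρ q).starProjection y with hu
  have hmem : u ∈ eigSpace ρ q := Submodule.starProjection_apply_mem _ y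
  have h1 : (eigSpace σ q).starProjection (slice y ψ) = slice u ψ := by
    refine Submodule.eq_starProjection_of_mem_of_inner_eq_zero
      (slice_mem_eigSpace hρ hσ hmem) fun z hz => ?_
    have hz' : slice z (swapU H K ψ) ∈ eigSpace ρ q :=
      slice_mem_eigSpace hσ (by rwa [swapU_swapU]) hz
    have h2 := Submodule.starProjection_inner_eq_zero y _ hz'
    rw [← inner_conj_symm, inner_sub_right, inner_slice, inner_slice, ← inner_sub_left,
      ← prodVec_sub_left, ← inner_slice, ← inner_slice_swapU, h2, map_zero]
  have h3 := hρ.inner_self u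
  rw [mem_eigSpace.mp hmem, inner_smul_right, inner_self_eq_norm_sq_to_K] at h3
  rw [h1]
  refine Complex.ofReal_injective ?_
  rw [← h3]
  push_cast
  rfl

/-- `⟨y, ρ h(ρ) y⟩ = ⟨ψ| (|y⟩⟨y| ⊗ h(σ)) |ψ⟩` for the two reduced operators `ρ` and `σ` of `ψ`. -/
theorem tsum_eigenbasis_slice {ψ : H ⊗ʰ K} {ρ : H →L[ℂ] H} {σ : K →L[ℂ] K}
    (hρ : IsMarginal ψ ρ) (hσ : IsMarginal (swapU H K ψ) σ)
    (b : HilbertBasis ι ℂ H) {p : ι → ℝ} (hb : ∀ i, ρ (b i) = (p i : ℂ) • b i)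
    (c : HilbertBasis κ ℂ K) {r : κ → ℝ} (hc : ∀ j, σ (c j) = (r j : ℂ) • c j)
    (h : ℝ → ℝ≥0∞) (y : H) :
    ∑' i, ENNReal.ofReal (‖⟪b i, y⟫_ℂ‖ ^ 2) * (ENNReal.ofReal (p i) * h (p i)) =
      ∑' m, ENNReal.ofReal (‖⟪prodVec y (c m), ψ⟫_ℂ‖ ^ 2) * h (r m) := by
  simp only [← inner_slice]
  rw [tsum_eigenbasis b hb (fun t => ENNReal.ofReal t * h t), tsum_eigenbasis c hc h]
  refine tsum_congr fun q => ?_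
  rw [norm_starProjection_slice_sq hρ hσ, ENNReal.ofReal_mul' (sq_nonneg _)]
  ring

end Spectral

/-! ### Mutual information of pure states -/

section Scalar

theorem mul_log_div_add_sub_nonneg {p q : ℝ} (hp : 0 ≤ p) (hq : 0 < q) :
    0 ≤ p * Real.log (p / q) + q - p := by
  rcases hp.eq_or_lt with rfl | hp
  · simpa using hq.le
  have h := mul_le_mul_of_nonneg_left (Real.one_sub_inv_le_log_of_pos (div_pos hp hq)) hp.le
  have e : p * (1 - (p / q)⁻¹) = p - q := by field_simp
  linarith

theorem ofReal_mul_ofReal_neg_log_le {p q : ℝ} (hp : 0 ≤ p) (hq : 0 ≤ q) :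
    ENNReal.ofReal p * ENNReal.ofReal (-Real.log (p / q)) ≤ ENNReal.ofReal q := by
  rcases hq.eq_or_lt with rfl | hq
  · simp
  rw [← ENNReal.ofReal_mul hp]
  refine ENNReal.ofReal_le_ofReal ?_
  linarith [mul_log_div_add_sub_nonneg hp hq]

/-- The summand of the relative entropy, rewritten without subtraction. -/
theorem weight_mul_relEntropyTerm {p q : ℝ} (hp : 0 ≤ p) (hq : 0 ≤ q) {W : ℝ≥0∞}
    (hW : q = 0 → W * ENNReal.ofReal p = 0) :
    W * relEntropyTerm p q + W * ENNReal.ofReal p +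
        W * (ENNReal.ofReal p * ENNReal.ofReal (-Real.log (p / q))) =
      W * (ENNReal.ofReal p * ENNReal.ofReal (Real.log (p / q))) + W * ENNReal.ofReal q := by
  rcases eq_or_ne W 0 with rfl | hW0
  · simp
  rcases hq.eq_or_lt with rfl | hq
  · have hp0 : p = 0 := by
      have := (mul_eq_zero.mp (hW rfl)).resolve_left hW0
      exact le_antisymm (ENNReal.ofReal_eq_zero.mp this) hp
    subst hp0
    simp [relEntropyTerm]
  have hF := mul_log_div_add_sub_nonneg hp hq
  rw [relEntropyTerm, if_neg (fun h => hq.ne' h.1), ← mul_add, ← mul_add, ← mul_add]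
  congr 1
  set l := Real.log (p / q)
  rcases le_total 0 l with hl | hl
  · rw [ENNReal.ofReal_of_nonpos (neg_nonpos.mpr hl), mul_zero, add_zero,
      ← ENNReal.ofReal_mul hp, ← ENNReal.ofReal_add hF hp,
      ← ENNReal.ofReal_add (by positivity) hq.le]
    congr 1
    ring
  · rw [ENNReal.ofReal_of_nonpos hl, mul_zero, zero_add, ← ENNReal.ofReal_mul hp,
      ← ENNReal.ofReal_add hF hp, ← ENNReal.ofReal_add (by positivity)
        (mul_nonneg hp (neg_nonneg.mpr hl))]
    congr 1
    ring

theorem ofReal_neg_add_ofReal_neg {x y s : ℝ} (hs : 0 ≤ s) (h : x + y = 2 * s) :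
    ENNReal.ofReal (-x) + ENNReal.ofReal (-y) + 2 * ENNReal.ofReal s =
      ENNReal.ofReal x + ENNReal.ofReal y := by
  have e : (2 : ℝ≥0∞) * ENNReal.ofReal s = ENNReal.ofReal (2 * s) := by
    rw [ENNReal.ofReal_mul zero_le_two, ENNReal.ofReal_ofNat]
  rw [e]
  rcases le_total 0 x with hx | hx <;> rcases le_total 0 y with hy | hy
  · rw [ENNReal.ofReal_of_nonpos (neg_nonpos.mpr hx), ENNReal.ofReal_of_nonpos (neg_nonpos.mpr hy),
      ← ENNReal.ofReal_add hx hy, h]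
    simp
  · rw [ENNReal.ofReal_of_nonpos (neg_nonpos.mpr hx), ENNReal.ofReal_of_nonpos hy,
      zero_add, add_zero, ← ENNReal.ofReal_add (by linarith) (by positivity)]
    congr 1; linarith
  · rw [ENNReal.ofReal_of_nonpos (neg_nonpos.mpr hy), ENNReal.ofReal_of_nonpos hx,
      zero_add, add_zero, ← ENNReal.ofReal_add (by linarith) (by positivity)]
    congr 1; linarith
  · have : s = 0 := by linarith
    subst this
    have hx0 : x = 0 := by linarith
    have hy0 : y = 0 := by linarith
    simp [hx0, hy0]

end Scalar

section MutualInformation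

variable {A B C H K : Type*}
  [NormedAddCommGroup A] [InnerProductSpace ℂ A] [CompleteSpace A]
  [NormedAddCommGroup B] [InnerProductSpace ℂ B] [CompleteSpace B]
  [NormedAddCommGroup C] [InnerProductSpace ℂ C] [CompleteSpace C]
  [NormedAddCommGroup H] [InnerProductSpace ℂ H] [CompleteSpace H]
  [NormedAddCommGroup K] [InnerProductSpace ℂ K] [CompleteSpace K]
variable {ι κ κ' μ : Type*}

theorem IsMarginal.eigenvalue_eq {ψ : H ⊗ʰ K} {ρ : H →L[ℂ] H} (hρ : IsMarginal ψ ρ)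
    (b : HilbertBasis ι ℂ H) {p : ι → ℝ} (hb : ∀ i, ρ (b i) = (p i : ℂ) • b i) (i : ι) :
    p i = ‖slice (b i) ψ‖ ^ 2 := by
  have h := hρ.inner_self (b i)
  rw [hb, inner_smul_right, inner_self_eq_norm_sq_to_K, b.orthonormal.1 i] at h
  refine Complex.ofReal_injective ?_
  rw [← h]
  simp

theorem IsMarginal.tsum_eigenvalue {ψ : H ⊗ʰ K} {ρ : H →L[ℂ] H} (hρ : IsMarginal ψ ρ)
    (b : HilbertBasis ι ℂ H) {p : ι → ℝ} (hb : ∀ i, ρ (b i) = (p i : ℂ) • b i) :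
    ∑' i, ENNReal.ofReal (p i) = ENNReal.ofReal (‖ψ‖ ^ 2) := by
  rw [← tsum_norm_slice_sq b]
  exact tsum_congr fun i => by rw [hρ.eigenvalue_eq b hb]

theorem slice_prodVec_slice (x : A) (y : B) (ψ : (A ⊗ʰ B) ⊗ʰ C) :
    slice y (slice x (assocU A B C ψ)) = slice (prodVec x y) ψ := by
  refine ext_inner_left ℂ fun z => ?_
  rw [inner_slice, inner_slice, inner_slice, inner_assocU]

theorem slice_prodVec_slice_right (x : A) (y : B) (ψ : (A ⊗ʰ B) ⊗ʰ C) :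
    slice x (slice y (assocU B A C (congrU (swapU A B) C ψ))) = slice (prodVec x y) ψ := by
  refine ext_inner_left ℂ fun z => ?_
  rw [inner_slice, inner_slice, inner_slice, inner_assocU, ← swapU_prodVec x y, inner_congrU]

/-- The mutual information `I(A;B)` of a pure state of `A ⊗ B ⊗ C`, in terms of the joint
distribution `w` of the outcomes of measuring eigenbases of the three reduced states, is the mean of
`log (γ / (α β))`. The negative part is kept on the left-hand side, as its mean is finite. -/
theorem stateMutualInfo_add_tsum_negPart {Ψ : (A ⊗ʰ B) ⊗ʰ C} (hΨ : ‖Ψ‖ = 1)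
    {ρ : A ⊗ʰ B →L[ℂ] A ⊗ʰ B} (hρ : IsMarginal Ψ ρ)
    {ρA : A →L[ℂ] A} (hA : IsMarginal (assocU A B C Ψ) ρA)
    {ρB : B →L[ℂ] B} (hB : IsMarginal (assocU B A C (congrU (swapU A B) C Ψ)) ρB)
    {ρC : C →L[ℂ] C} (hC : IsMarginal (swapU (A ⊗ʰ B) C Ψ) ρC)
    (a : HilbertBasis κ ℂ A) {α : κ → ℝ} (ha : ∀ k, ρA (a k) = (α k : ℂ) • a k)
    (b : HilbertBasis κ' ℂ B) {β : κ' → ℝ} (hb : ∀ l, ρB (b l) = (β l : ℂ) • b l)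
    (c : HilbertBasis μ ℂ C) {γ : μ → ℝ} (hc : ∀ m, ρC (c m) = (γ m : ℂ) • c m) :
    ∃ D : ℝ≥0∞, stateMutualInfo ρ = ENNReal.ofReal (Real.log 2)⁻¹ * D ∧
      D + ∑' (k) (l) (m), ENNReal.ofReal (‖⟪prodVec (prodVec (a k) (b l)) (c m), Ψ⟫_ℂ‖ ^ 2) *
          ENNReal.ofReal (-Real.log (γ m / (α k * β l))) =
        ∑' (k) (l) (m), ENNReal.ofReal (‖⟪prodVec (prodVec (a k) (b l)) (c m), Ψ⟫_ℂ‖ ^ 2) *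
          ENNReal.ofReal (Real.log (γ m / (α k * β l))) ∧
      ∑' (k) (l) (m), ENNReal.ofReal (‖⟪prodVec (prodVec (a k) (b l)) (c m), Ψ⟫_ℂ‖ ^ 2) *
          ENNReal.ofReal (-Real.log (γ m / (α k * β l))) ≠ ⊤ := by
  obtain ⟨r⟩ := hρ.exists_spectralDecomposition
  have hα := hA.eigenvalue_eq a ha
  have hβ := hB.eigenvalue_eq b hb
  have hα0 : ∀ k, 0 ≤ α k := fun k => by rw [hα]; positivity
  have hβ0 : ∀ l, 0 ≤ β l := fun l => by rw [hβ]; positivity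
  have hp0 : ∀ i, 0 ≤ r.eigenvalue i := fun i => by
    rw [hρ.eigenvalue_eq r.basis r.apply_basis]; positivity
  have hq0 : ∀ k l, 0 ≤ α k * β l := fun k l => mul_nonneg (hα0 k) (hβ0 l)
  have hprod : ∀ j : κ × κ', opTensor (traceRight ρ) (traceLeft ρ) (prodBasis a b j) =
      ((α j.1 * β j.2 : ℝ) : ℂ) • prodBasis a b j := fun j => by
    rw [hρ.traceRight.unique hA, hρ.traceLeft.unique hB, prodBasis_apply, opTensor_prodVec, ha, hb,
      ← insertRight_apply, map_smul, insertRight_apply, ← insertLeft_apply, map_smul,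
      insertLeft_apply, smul_smul]
    push_cast
    rfl
  -- `W k l i` is the transition probability from `a k ⊗ b l` to the `i`-th eigenvector of `ρ`.
  set W : κ → κ' → r.index → ℝ≥0∞ := fun k l i =>
    ENNReal.ofReal (‖⟪r.basis i, prodVec (a k) (b l)⟫_ℂ‖ ^ 2) with hW
  set w : κ → κ' → μ → ℝ≥0∞ := fun k l m =>
    ENNReal.ofReal (‖⟪prodVec (prodVec (a k) (b l)) (c m), Ψ⟫_ℂ‖ ^ 2) with hw
  have hWw : ∀ (h : ℝ → ℝ≥0∞) k l,
      ∑' i, W k l i * (ENNReal.ofReal (r.eigenvalue i) * h (r.eigenvalue i)) =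
        ∑' m, w k l m * h (γ m) := fun h k l =>
    tsum_eigenbasis_slice hρ hC r.basis r.apply_basis c hc h _
  have hWw1 : ∀ k l, ∑' i, W k l i * ENNReal.ofReal (r.eigenvalue i) = ∑' m, w k l m :=
    fun k l => by simpa using hWw (fun _ => 1) k l
  have hW1 : ∀ k l, ∑' i, W k l i = 1 := fun k l => by
    rw [hW, tsum_norm_inner_sq, norm_prodVec, a.orthonormal.1, b.orthonormal.1]
    simp
  have hw1 : ∑' (k) (l) (m), w k l m = 1 := by
    have h := tsum_norm_inner_sq (prodBasis (prodBasis a b) c) Ψ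
    rw [ENNReal.tsum_prod', ENNReal.tsum_prod', hΨ] at h
    simpa only [prodBasis_apply, one_pow, ENNReal.ofReal_one] using h
  have hq1 : ∑' (k) (l), ENNReal.ofReal (α k * β l) = 1 := by
    rw [tsum_congr fun k => tsum_congr fun l => ENNReal.ofReal_mul (q := β l) (hα0 k)]
    simp only [ENNReal.tsum_mul_left, ENNReal.tsum_mul_right]
    rw [hA.tsum_eigenvalue a ha, hB.tsum_eigenvalue b hb]
    simp [hΨ]
  -- Where `α k * β l = 0`, the vector `a k ⊗ b l` is orthogonal to the support of `ρ`.
  have hvanish : ∀ k l i, α k * β l = 0 → W k l i * ENNReal.ofReal (r.eigenvalue i) = 0 := by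
    intro k l i h
    have hs : slice (prodVec (a k) (b l)) Ψ = 0 := by
      rcases mul_eq_zero.mp h with h | h
      · rw [hα, sq_eq_zero_iff, norm_eq_zero] at h
        rw [← slice_prodVec_slice, h]
        exact map_zero _
      · rw [hβ, sq_eq_zero_iff, norm_eq_zero] at h
        rw [← slice_prodVec_slice_right, h]
        exact map_zero _
    have h2 := hWw1 k l
    have h3 : ∀ m, w k l m = 0 := fun m => by
      rw [hw]; dsimp only; rw [← inner_slice, hs]; simp
    simp only [h3, tsum_zero, ENNReal.tsum_eq_zero] at h2
    exact h2 i
  refine ⟨∑' (k) (l) (i), W k l i * relEntropyTerm (r.eigenvalue i) (α k * β l), ?_, ?_, ?_⟩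
  · rw [stateMutualInfo, relEntropy_eq r.basis r.apply_basis (prodBasis a b) hprod,
      ENNReal.tsum_prod']
    simp only [prodBasis_apply, hW]
  · have key : ∀ k l, ∑' i, W k l i * relEntropyTerm (r.eigenvalue i) (α k * β l) +
        ∑' m, w k l m + ∑' m, w k l m * ENNReal.ofReal (-Real.log (γ m / (α k * β l))) =
        ∑' m, w k l m * ENNReal.ofReal (Real.log (γ m / (α k * β l))) +
          ENNReal.ofReal (α k * β l) := fun k l => by
      rw [← hWw1, ← hWw (fun t => ENNReal.ofReal (-Real.log (t / (α k * β l)))),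
        ← hWw (fun t => ENNReal.ofReal (Real.log (t / (α k * β l)))),
        ← one_mul (ENNReal.ofReal (α k * β l)), ← hW1 k l, ← ENNReal.tsum_mul_right,
        ← ENNReal.tsum_add, ← ENNReal.tsum_add, ← ENNReal.tsum_add]
      exact tsum_congr fun i => weight_mul_relEntropyTerm (hp0 i) (hq0 k l) (hvanish k l i)
    have key2 := tsum_congr (L := .unconditional _) fun k =>
      tsum_congr (L := .unconditional _) fun l => key k l
    simp only [ENNReal.tsum_add] at key2
    rw [hw1, hq1, add_right_comm] at key2
    exact (ENNReal.add_left_inj ENNReal.one_ne_top).mp key2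
  · refine ne_top_of_le_ne_top ENNReal.one_ne_top ?_
    rw [← hq1]
    refine ENNReal.tsum_le_tsum fun k => ENNReal.tsum_le_tsum fun l => ?_
    rw [← hWw (fun t => ENNReal.ofReal (-Real.log (t / (α k * β l))))]
    calc _ ≤ ∑' i, W k l i * ENNReal.ofReal (α k * β l) :=
          ENNReal.tsum_le_tsum fun i => by
            gcongr
            exact ofReal_mul_ofReal_neg_log_le (hp0 i) (hq0 k l)
      _ = ENNReal.ofReal (α k * β l) := by rw [ENNReal.tsum_mul_right, hW1, one_mul]

/-- The entropy `-∑ₖ αₖ ln αₖ` (in nats) of a state with eigenvalues `αₖ`. -/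
def SpectralDecomposition.entropy {ρ : H →L[ℂ] H} (d : SpectralDecomposition ρ) : ℝ≥0∞ :=
  ∑' k, ENNReal.ofReal (d.eigenvalue k) * ENNReal.ofReal (-Real.log (d.eigenvalue k))

/-- A reduced operator only depends on the vector up to a unitary of the complement. -/
theorem IsMarginal.of_unitary {ψ : H ⊗ʰ A} {ψ' : H ⊗ʰ B} {ρ : H →L[ℂ] H} (hρ : IsMarginal ψ ρ)
    (U : A ≃ₗᵢ[ℂ] B) (h : ∀ x z, ⟪prodVec x (U z), ψ'⟫_ℂ = ⟪prodVec x z, ψ⟫_ℂ) :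
    IsMarginal ψ' ρ := fun x y => by
  have hs : ∀ x, slice x ψ' = U (slice x ψ) := fun x => by
    refine ext_inner_left ℂ fun z => ?_
    rw [← U.apply_symm_apply z, U.inner_map_map, inner_slice, inner_slice, h]
  rw [hs, hs, U.inner_map_map, hρ]

theorem inner_assocU_rightSwapU (X : (A ⊗ʰ B) ⊗ʰ C) (x : A) (z : B ⊗ʰ C) :
    ⟪prodVec x (swapU B C z), assocU A C B (rightSwapU A B C X)⟫_ℂ =
      ⟪prodVec x z, assocU A B C X⟫_ℂ := by
  refine inner_prodVec_eq_of_forall (T := insertLeft _ x ∘L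
    (swapU B C).toContinuousLinearEquiv.toContinuousLinearMap) (S := insertLeft _ x)
    (fun y z => ?_) z
  simp only [ContinuousLinearMap.comp_apply, insertLeft_apply]
  change ⟪prodVec x (swapU B C (prodVec y z)), _⟫_ℂ = _
  rw [swapU_prodVec, inner_assocU, inner_assocU, inner_rightSwapU]

theorem assocU_congrU_rightSwapU (X : (A ⊗ʰ B) ⊗ʰ C) :
    assocU C A B (congrU (swapU A C) B (rightSwapU A B C X)) = swapU (A ⊗ʰ B) C X := by
  refine ext_inner_prodVec fun z u => ?_
  refine inner_prodVec_eq_of_forall (T := insertLeft _ z) (S := insertLeft _ z) (fun x y => ?_) u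
  simp only [insertLeft_apply]
  rw [inner_assocU, ← swapU_prodVec x z, inner_congrU, inner_rightSwapU, inner_swapU]

theorem swapU_rightSwapU (X : (A ⊗ʰ B) ⊗ʰ C) :
    swapU (A ⊗ʰ C) B (rightSwapU A B C X) = assocU B A C (congrU (swapU A B) C X) := by
  refine ext_inner_prodVec fun y u => ?_
  refine inner_prodVec_eq_of_forall (T := insertLeft _ y) (S := insertLeft _ y) (fun x z => ?_) u
  simp only [insertLeft_apply]
  rw [inner_assocU, ← swapU_prodVec x y, inner_congrU, inner_swapU, inner_rightSwapU]

theorem exists_marginal (ψ : H ⊗ʰ K) : ∃ ρ : H →L[ℂ] H, IsMarginal ψ ρ :=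
  ⟨_, isMarginal_traceRight_rankOne ψ⟩

/-- For a pure state of `A ⊗ B ⊗ C`, `I(A;B) + I(A;C) = 2 S(A)`, even if entropies are infinite:
the means of `log (γ / (α β))` and `log (β / (α γ))` add up to that of `-2 log α`. -/
theorem stateMutualInfo_add_stateMutualInfo {X : (A ⊗ʰ B) ⊗ʰ C} (hX : ‖X‖ = 1)
    {ρ : A ⊗ʰ B →L[ℂ] A ⊗ʰ B} (hρ : IsMarginal X ρ)
    {ρ' : A ⊗ʰ C →L[ℂ] A ⊗ʰ C} (hρ' : IsMarginal (rightSwapU A B C X) ρ')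
    {ρA : A →L[ℂ] A} (hA : IsMarginal (assocU A B C X) ρA) (d : SpectralDecomposition ρA) :
    stateMutualInfo ρ + stateMutualInfo ρ' =
      ENNReal.ofReal (Real.log 2)⁻¹ * (2 * d.entropy) := by
  obtain ⟨ρB, hB⟩ := exists_marginal (assocU B A C (congrU (swapU A B) C X))
  obtain ⟨ρC, hC⟩ := exists_marginal (swapU (A ⊗ʰ B) C X)
  obtain ⟨b⟩ := hB.exists_spectralDecomposition
  obtain ⟨c⟩ := hC.exists_spectralDecomposition
  obtain ⟨D₁, h₁, e₁, f₁⟩ := stateMutualInfo_add_tsum_negPart hX hρ hA hB hC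
    d.basis d.apply_basis b.basis b.apply_basis c.basis c.apply_basis
  have hA' : IsMarginal (assocU A C B (rightSwapU A B C X)) ρA :=
    hA.of_unitary (swapU B C) (inner_assocU_rightSwapU X)
  obtain ⟨D₂, h₂, e₂, f₂⟩ := stateMutualInfo_add_tsum_negPart
    (((rightSwapU A B C).norm_map X).trans hX) hρ' hA'
    (by rw [assocU_congrU_rightSwapU]; exact hC) (by rw [swapU_rightSwapU]; exact hB)
    d.basis d.apply_basis c.basis c.apply_basis b.basis b.apply_basis
  simp only [inner_rightSwapU] at e₂ f₂
  have comm : ∀ f : d.index → c.index → b.index → ℝ≥0∞,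
      ∑' (k) (m) (l), f k m l = ∑' (k) (l) (m), f k m l := fun f =>
    tsum_congr fun k => ENNReal.tsum_comm
  rw [comm] at f₂
  rw [comm, comm] at e₂
  rw [h₁, h₂, ← mul_add]
  congr 1
  have hα := hA.eigenvalue_eq d.basis d.apply_basis
  have hβ := hB.eigenvalue_eq b.basis b.apply_basis
  have hγ := hC.eigenvalue_eq c.basis c.apply_basis
  set w : d.index → b.index → c.index → ℝ≥0∞ := fun k l m =>
    ENNReal.ofReal (‖⟪prodVec (prodVec (d.basis k) (b.basis l)) (c.basis m), X⟫_ℂ‖ ^ 2) with hw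
  have hwα : ∀ k, ∑' (l) (m), w k l m = ENNReal.ofReal (d.eigenvalue k) := fun k => by
    have h := tsum_norm_inner_sq (prodBasis b.basis c.basis)
      (slice (d.basis k) (assocU A B C X))
    rw [ENNReal.tsum_prod', ← hα] at h
    simpa only [prodBasis_apply, inner_slice, inner_assocU] using h
  have hα1 : ∀ k, d.eigenvalue k ≤ 1 := fun k => by
    have h := norm_slice_le (d.basis k) (assocU A B C X)
    rw [d.basis.orthonormal.1, LinearIsometryEquiv.norm_map, hX, one_mul] at h
    rw [hα]
    exact pow_le_one₀ (norm_nonneg _) h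
  have hpt : ∀ k l m, w k l m * ENNReal.ofReal
        (-Real.log (c.eigenvalue m / (d.eigenvalue k * b.eigenvalue l))) +
      w k l m * ENNReal.ofReal
        (-Real.log (b.eigenvalue l / (d.eigenvalue k * c.eigenvalue m))) +
      w k l m * (2 * ENNReal.ofReal (-Real.log (d.eigenvalue k))) =
      w k l m * ENNReal.ofReal
        (Real.log (c.eigenvalue m / (d.eigenvalue k * b.eigenvalue l))) +
      w k l m * ENNReal.ofReal
        (Real.log (b.eigenvalue l / (d.eigenvalue k * c.eigenvalue m))) := by
    intro k l m
    rcases eq_or_ne (w k l m) 0 with h0 | h0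
    · simp [h0]
    have hne : ⟪prodVec (prodVec (d.basis k) (b.basis l)) (c.basis m), X⟫_ℂ ≠ 0 := fun h => by
      apply h0; simp [hw, h]
    have ha0 : d.eigenvalue k ≠ 0 := fun h => by
      rw [hα, sq_eq_zero_iff, norm_eq_zero] at h
      apply hne
      rw [← inner_assocU, ← inner_slice, h, inner_zero_right]
    have hb0 : b.eigenvalue l ≠ 0 := fun h => by
      rw [hβ, sq_eq_zero_iff, norm_eq_zero] at h
      apply hne
      rw [← inner_slice, ← slice_prodVec_slice_right, h, slice, map_zero, inner_zero_right]
    have hc0 : c.eigenvalue m ≠ 0 := fun h => by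
      rw [hγ, sq_eq_zero_iff, norm_eq_zero] at h
      apply hne
      rw [← inner_swapU, ← inner_slice, h, inner_zero_right]
    have ha0' : 0 ≤ d.eigenvalue k := by rw [hα]; positivity
    rw [← mul_add, ← mul_add, ← mul_add, ofReal_neg_add_ofReal_neg
      (neg_nonneg.mpr (Real.log_nonpos ha0' (hα1 k)))]
    rw [Real.log_div hc0 (mul_ne_zero ha0 hb0), Real.log_div hb0 (mul_ne_zero ha0 hc0),
      Real.log_mul ha0 hb0, Real.log_mul ha0 hc0]
    ring
  have hsum := tsum_congr (L := .unconditional _) fun k => tsum_congr (L := .unconditional _)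
    fun l => tsum_congr (L := .unconditional _) fun m => hpt k l m
  simp only [ENNReal.tsum_add] at hsum
  have hS : ∑' (k) (l) (m), w k l m * (2 * ENNReal.ofReal (-Real.log (d.eigenvalue k))) =
      2 * d.entropy := by
    simp only [ENNReal.tsum_mul_right, hwα, SpectralDecomposition.entropy]
    rw [← ENNReal.tsum_mul_left]
    exact tsum_congr fun k => by ring
  rw [hS, ← e₁, ← e₂] at hsum
  have hfin := ENNReal.add_ne_top.mpr ⟨f₁, f₂⟩
  refine ((ENNReal.add_right_inj hfin).mp (hsum.trans ?_)).symm
  ring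

end MutualInformation

/-! ### Duality of differences of mutual informations -/

section Duality

variable {A B C E F H : Type*}
  [NormedAddCommGroup A] [InnerProductSpace ℂ A] [CompleteSpace A]
  [NormedAddCommGroup B] [InnerProductSpace ℂ B] [CompleteSpace B]
  [NormedAddCommGroup C] [InnerProductSpace ℂ C] [CompleteSpace C]
  [NormedAddCommGroup E] [InnerProductSpace ℂ E] [CompleteSpace E]
  [NormedAddCommGroup F] [InnerProductSpace ℂ F] [CompleteSpace F]
  [NormedAddCommGroup H] [InnerProductSpace ℂ H] [CompleteSpace H]

theorem mutualInfo_of_isMarginal_zero {ρ : A ⊗ʰ B →L[ℂ] A ⊗ʰ B}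
    (hρ : IsMarginal (0 : (A ⊗ʰ B) ⊗ʰ C) ρ) : mutualInfo ρ = 0 := by
  rw [mutualInfo, hρ.opTrace]
  simp

theorem mutualInfo_of_isMarginal {X : (A ⊗ʰ B) ⊗ʰ C} {ρ : A ⊗ʰ B →L[ℂ] A ⊗ʰ B}
    (hρ : IsMarginal X ρ) :
    mutualInfo ρ = ENNReal.ofReal (‖X‖ ^ 2) * stateMutualInfo (((‖X‖⁻¹ ^ 2 : ℝ) : ℂ) • ρ) := by
  rw [mutualInfo, hρ.opTrace, ENNReal.toReal_ofReal (sq_nonneg _)]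
  congr 3
  push_cast
  rw [inv_pow]

theorem SpectralDecomposition.entropy_ne_top {ρ : H →L[ℂ] H} (d : SpectralDecomposition ρ)
    (hρ : FiniteDimensional ℂ ρ.range) : d.entropy ≠ ⊤ := by
  let S : Set d.index := {k | d.eigenvalue k ≠ 0}
  have hmem : ∀ k : S, d.basis k ∈ ρ.range := fun k => by
    refine ⟨((d.eigenvalue k : ℂ))⁻¹ • d.basis k, ?_⟩
    rw [ContinuousLinearMap.coe_coe, map_smul, d.apply_basis, smul_smul, inv_mul_cancel₀, one_smul]
    exact_mod_cast k.2
  have hli : LinearIndependent ℂ (fun k : S => (⟨d.basis k, hmem k⟩ : ρ.range)) := by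
    refine LinearIndependent.of_comp ρ.range.subtype ?_
    exact d.basis.orthonormal.linearIndependent.comp _ Subtype.val_injective
  have hS : S.Finite := hli.finite
  rw [SpectralDecomposition.entropy, tsum_eq_sum (s := hS.toFinset)]
  · exact ENNReal.sum_ne_top.mpr fun k _ => ENNReal.mul_ne_top ENNReal.ofReal_ne_top
      ENNReal.ofReal_ne_top
  · intro k hk
    have h0 : d.eigenvalue k = 0 := by
      by_contra h
      exact hk (hS.mem_toFinset.mpr h)
    simp [h0]

/-- `I(A;B) + I(A;C) = 2 S(A)` without normalisation. The value only depends on the reduced operator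
on `A` and on the norm. -/
theorem mutualInfo_add_mutualInfo {ρA : A →L[ℂ] A} {t : ℝ}
    (ht : 0 < t) (d : SpectralDecomposition (((t⁻¹ ^ 2 : ℝ) : ℂ) • ρA))
    {X : (A ⊗ʰ B) ⊗ʰ C} (hX : ‖X‖ = t)
    {ρ : A ⊗ʰ B →L[ℂ] A ⊗ʰ B} (hρ : IsMarginal X ρ)
    {ρ' : A ⊗ʰ C →L[ℂ] A ⊗ʰ C} (hρ' : IsMarginal (rightSwapU A B C X) ρ')
    (hA : IsMarginal (assocU A B C X) ρA) :
    mutualInfo ρ + mutualInfo ρ' =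
      ENNReal.ofReal (t ^ 2) * (ENNReal.ofReal (Real.log 2)⁻¹ * (2 * d.entropy)) := by
  have hX' : ‖rightSwapU A B C X‖ = t := ((rightSwapU A B C).norm_map X).trans hX
  rw [mutualInfo_of_isMarginal hρ, mutualInfo_of_isMarginal hρ', hX, hX', ← mul_add]
  congr 1
  refine stateMutualInfo_add_stateMutualInfo (X := ((t⁻¹ : ℝ) : ℂ) • X) ?_ (hρ.smul _) ?_ ?_ d
  · rw [norm_smul, hX, Complex.norm_real, Real.norm_of_nonneg (inv_nonneg.mpr ht.le),
      inv_mul_cancel₀ ht.ne']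
  · rw [map_smul]; exact hρ'.smul _
  · rw [map_smul]; exact hA.smul _

theorem coe_sub_coe_eq_of_add_eq {a b c d s : ℝ≥0∞} (hs : s ≠ ⊤) (h₁ : a + d = s)
    (h₂ : c + b = s) : (a : EReal) - b = (c : EReal) - d := by
  obtain ⟨ha, hd⟩ := ENNReal.add_ne_top.mp (h₁ ▸ hs)
  obtain ⟨hc, hb⟩ := ENNReal.add_ne_top.mp (h₂ ▸ hs)
  have h := h₁.trans h₂.symm
  lift a to NNReal using ha
  lift b to NNReal using hb
  lift c to NNReal using hc
  lift d to NNReal using hd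
  have h' : (a : ℝ) + d = c + b := by exact_mod_cast h
  simp only [EReal.coe_nnreal_eq_coe_real]
  norm_cast
  linarith

/-- `I(A;Y) - I(A;E) = I(A;Y') - I(A;F)` for two purifications `X ∈ (A ⊗ Y) ⊗ F` and
`X' ∈ (A ⊗ Y') ⊗ E` of the same operator of finite rank on `A`: by
`mutualInfo_add_mutualInfo`, both `I(A;Y) + I(A;F)` and `I(A;Y') + I(A;E)` are `2 S(A) < ∞`. -/
theorem mutualInfo_sub_mutualInfo_eq {Y Y' : Type*}
    [NormedAddCommGroup Y] [InnerProductSpace ℂ Y] [CompleteSpace Y]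
    [NormedAddCommGroup Y'] [InnerProductSpace ℂ Y'] [CompleteSpace Y']
    {X : (A ⊗ʰ Y) ⊗ʰ F} {X' : (A ⊗ʰ Y') ⊗ʰ E} {ρA : A →L[ℂ] A}
    (hfin : FiniteDimensional ℂ ρA.range) (hX : ‖X‖ = ‖X'‖)
    (hA : IsMarginal (assocU A Y F X) ρA) (hA' : IsMarginal (assocU A Y' E X') ρA)
    {ρ₁ : A ⊗ʰ Y →L[ℂ] A ⊗ʰ Y} (h₁ : IsMarginal X ρ₁)
    {ρ₂ : A ⊗ʰ E →L[ℂ] A ⊗ʰ E} (h₂ : IsMarginal (rightSwapU A Y' E X') ρ₂)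
    {ρ₃ : A ⊗ʰ Y' →L[ℂ] A ⊗ʰ Y'} (h₃ : IsMarginal X' ρ₃)
    {ρ₄ : A ⊗ʰ F →L[ℂ] A ⊗ʰ F} (h₄ : IsMarginal (rightSwapU A Y F X) ρ₄) :
    (mutualInfo ρ₁ : EReal) - (mutualInfo ρ₂ : EReal) =
      (mutualInfo ρ₃ : EReal) - (mutualInfo ρ₄ : EReal) := by
  rcases eq_or_ne X 0 with rfl | h0
  · have h0' : X' = 0 := by rw [← norm_eq_zero, ← hX, norm_zero]
    subst h0'
    rw [map_zero] at h₂ h₄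
    rw [mutualInfo_of_isMarginal_zero h₁, mutualInfo_of_isMarginal_zero h₂,
      mutualInfo_of_isMarginal_zero h₃, mutualInfo_of_isMarginal_zero h₄]
  have ht : 0 < ‖X‖ := norm_pos_iff.mpr h0
  obtain ⟨d⟩ := (hA.smul ‖X‖⁻¹).exists_spectralDecomposition
  have hd : d.entropy ≠ ⊤ := by
    refine d.entropy_ne_top ?_
    refine Submodule.finiteDimensional_of_le (S₂ := ρA.range) ?_
    rintro _ ⟨y, rfl⟩
    exact ρA.range.smul_mem _ ⟨y, rfl⟩
  refine coe_sub_coe_eq_of_add_eq ?_ (mutualInfo_add_mutualInfo ht d rfl h₁ h₄ hA)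
    (mutualInfo_add_mutualInfo ht d hX.symm h₃ h₂ hA')
  exact ENNReal.mul_ne_top ENNReal.ofReal_ne_top (ENNReal.mul_ne_top ENNReal.ofReal_ne_top
    (ENNReal.mul_ne_top ENNReal.ofNat_ne_top hd))

theorem IsMarginal.comp_eq_of_forall {P : A →L[ℂ] A} (hP : P.adjoint = P) {Z : A ⊗ʰ B}
    {ρ : A →L[ℂ] A} (hρ : IsMarginal Z ρ)
    (h : ∀ a u, ⟪prodVec (P a) u, Z⟫_ℂ = ⟪prodVec a u, Z⟫_ℂ) : P ∘L ρ = ρ := by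
  ext y
  refine ext_inner_left ℂ fun x => ?_
  have hs : slice (P x) Z = slice x Z :=
    ext_inner_left ℂ fun u => by rw [inner_slice, inner_slice, h]
  rw [ContinuousLinearMap.comp_apply, ← ContinuousLinearMap.adjoint_inner_left, hP, hρ, hρ, hs]

end Duality

/-! ### Composite systems -/

open HilbertSystem

section Systems

variable {A B C E F G H K L M : HilbertSystem.{u}}

/-- The product vector `x ⊗ y` of the composite system. The operations on composite systems are
those on Hilbert-space tensor products. As `HilbertSystem.tensor` is not reducible, they keep the
instance arguments of repeated tensor products small. -/
def prodS (x : A) (y : B) : tensor A B := prodVec x y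

/-- The unitary `(A ⊗ B) ⊗ C ≃ A ⊗ (B ⊗ C)` of composite systems. -/
def assocS (A B C : HilbertSystem.{u}) : tensor (tensor A B) C ≃ₗᵢ[ℂ] tensor A (tensor B C) :=
  assocU A B C

/-- The unitary `A ⊗ B ≃ B ⊗ A` of composite systems. -/
def swapS (A B : HilbertSystem.{u}) : tensor A B ≃ₗᵢ[ℂ] tensor B A := swapU A B

/-- The unitary `U ⊗ 1` of composite systems. -/
def congrS (U : A ≃ₗᵢ[ℂ] B) (C : HilbertSystem.{u}) : tensor A C ≃ₗᵢ[ℂ] tensor B C := congrU U C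

/-- The unitary `(A ⊗ B) ⊗ C ≃ (A ⊗ C) ⊗ B` of composite systems. -/
def rightSwapS (A B C : HilbertSystem.{u}) :
    tensor (tensor A B) C ≃ₗᵢ[ℂ] tensor (tensor A C) B :=
  rightSwapU A B C

/-- The operator `R ⊗ 1` of composite systems. -/
def opTensorId (R : A →L[ℂ] A) (B : HilbertSystem.{u}) : tensor A B →L[ℂ] tensor A B :=
  opTensor R (ContinuousLinearMap.id ℂ B)

/-- `ρ` is the reduced operator on `A` of a vector of the composite system `A ⊗ B`. -/
def IsMarginalS (ψ : tensor A B) (ρ : A →L[ℂ] A) : Prop := IsMarginal (K := B) ψ ρ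

/-- The partial trace over `B` of an operator on the composite system `(A ⊗ B) ⊗ C`. -/
def traceMidS (ρ : tensor (tensor A B) C →L[ℂ] tensor (tensor A B) C) :
    tensor A C →L[ℂ] tensor A C :=
  traceMid (H := A) (K := B) (L := C) ρ

/-- The mutual information of an operator on the composite system `A ⊗ B`. -/
def mutualInfoS (ρ : tensor A B →L[ℂ] tensor A B) : ℝ≥0∞ := mutualInfo (H := A) (K := B) ρ

/-- The conditional mutual information of an operator on the composite system `(A ⊗ B) ⊗ E`. -/
def condMutualInfoS (ω : tensor (tensor A B) E →L[ℂ] tensor (tensor A B) E) : EReal :=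
  condMutualInfo (H := A) (K := B) (L := E) ω

theorem condMutualInfoS_eq (ω : tensor (tensor A B) E →L[ℂ] tensor (tensor A B) E) :
    condMutualInfoS ω = ⨆ (P : A →L[ℂ] A) (_ : IsFiniteRankProjection P),
      ((mutualInfoS (conjU (assocS A B E) (opTensorId (opTensorId P B) E ∘L ω ∘L
        opTensorId (opTensorId P B) E)) : EReal) -
      (mutualInfoS (traceMidS (opTensorId (opTensorId P B) E ∘L ω ∘L
        opTensorId (opTensorId P B) E)) : EReal)) :=
  rfl

theorem inner_assocS (x : A) (y : B) (z : C) (ψ : tensor (tensor A B) C) :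
    ⟪prodS x (prodS y z), assocS A B C ψ⟫_ℂ = ⟪prodS (prodS x y) z, ψ⟫_ℂ :=
  inner_assocU x y z ψ

theorem assocS_prodS (x : A) (y : B) (z : C) :
    assocS A B C (prodS (prodS x y) z) = prodS x (prodS y z) :=
  assocU_prodVec x y z

theorem inner_congrS (U : A ≃ₗᵢ[ℂ] B) (x : A) (z : C) (ψ : tensor A C) :
    ⟪prodS (U x) z, congrS U C ψ⟫_ℂ = ⟪prodS x z, ψ⟫_ℂ :=
  inner_congrU U x z ψ

theorem inner_rightSwapS (x : A) (y : B) (z : C) (ψ : tensor (tensor A B) C) :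
    ⟪prodS (prodS x z) y, rightSwapS A B C ψ⟫_ℂ = ⟪prodS (prodS x y) z, ψ⟫_ℂ :=
  inner_rightSwapU x y z ψ

theorem rightSwapS_prodS (x : A) (y : B) (z : C) :
    rightSwapS A B C (prodS (prodS x y) z) = prodS (prodS x z) y :=
  rightSwapU_prodVec x y z

theorem opTensorId_prodS (R : A →L[ℂ] A) (x : A) (y : B) :
    opTensorId R B (prodS x y) = prodS (R x) y :=
  opTensor_prodVec R _ x y

theorem adjoint_opTensorId {R : A →L[ℂ] A} (hR : R.adjoint = R) :
    (opTensorId R B).adjoint = opTensorId R B := by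
  refine (adjoint_opTensor R (ContinuousLinearMap.id ℂ B)).trans ?_
  rw [hR, ContinuousLinearMap.adjoint_id]
  rfl

theorem inner_opTensorId {R : A →L[ℂ] A} (hR : R.adjoint = R) (x : A) (y : B) (ψ : tensor A B) :
    ⟪prodS x y, opTensorId R B ψ⟫_ℂ = ⟪prodS (R x) y, ψ⟫_ℂ := by
  rw [← ContinuousLinearMap.adjoint_inner_left, adjoint_opTensorId hR, opTensorId_prodS]

theorem inner_eq_of_forall_prodS {T : tensor A B →L[ℂ] C} {S : tensor A B →L[ℂ] E} {u : C} {v : E}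
    (h : ∀ x y, ⟪T (prodS x y), u⟫_ℂ = ⟪S (prodS x y), v⟫_ℂ) (z : tensor A B) :
    ⟪T z, u⟫_ℂ = ⟪S z, v⟫_ℂ :=
  inner_prodVec_eq_of_forall (H := A) (K := B) (T := T) (S := S) h z

theorem ext_inner_prodS {u v : tensor A B} (h : ∀ x y, ⟪prodS x y, u⟫_ℂ = ⟪prodS x y, v⟫_ℂ) :
    u = v :=
  ext_inner_prodVec h

/-- The operator `x ↦ k ⊗ x` of composite systems. -/
def insertLeftS (A : HilbertSystem.{u}) (k : B) : A →L[ℂ] tensor B A := insertLeft A k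

/-- The operator `x ↦ x ⊗ k` of composite systems. -/
def insertRightS (A : HilbertSystem.{u}) (k : B) : A →L[ℂ] tensor A B := insertRight A k

theorem ext_inner_prodS_left {u v : tensor (tensor A B) C}
    (h : ∀ x y z, ⟪prodS (prodS x y) z, u⟫_ℂ = ⟪prodS (prodS x y) z, v⟫_ℂ) : u = v :=
  ext_inner_prodS fun w z => inner_eq_of_forall_prodS (T := insertRightS _ z)
    (S := insertRightS _ z) (fun x y => h x y z) w

theorem inner_insert_eq_of_forall {U : tensor (tensor B E) F →L[ℂ] G} {a a' : A} {u : tensor A G}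
    {v : tensor A (tensor (tensor B E) F)}
    (h : ∀ b e f, ⟪prodS a' (U (prodS (prodS b e) f)), u⟫_ℂ =
      ⟪prodS a (prodS (prodS b e) f), v⟫_ℂ) (z : tensor (tensor B E) F) :
    ⟪prodS a' (U z), u⟫_ℂ = ⟪prodS a z, v⟫_ℂ :=
  inner_eq_of_forall_prodS (T := insertLeftS G a' ∘L U) (S := insertLeftS _ a)
    (fun w f => inner_eq_of_forall_prodS (T := insertLeftS G a' ∘L U ∘L insertRightS _ f)
      (S := insertLeftS _ a ∘L insertRightS _ f) (fun b e => h b e f) w) z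

theorem rightSwapS_rightSwapS (ψ : tensor (tensor A B) C) :
    rightSwapS A C B (rightSwapS A B C ψ) = ψ :=
  ext_inner_prodS_left fun x y z => by rw [inner_rightSwapS, inner_rightSwapS]

theorem rightSwapS_congrS (U : A ≃ₗᵢ[ℂ] H) (ψ : tensor (tensor A E) F) :
    rightSwapS H E F (congrS (congrS U E) F ψ) = congrS (congrS U F) E (rightSwapS A E F ψ) :=
  ext_inner_prodS_left fun x f e => by
    obtain ⟨x, rfl⟩ := U.surjective x
    have h : ∀ (G : HilbertSystem.{u}) (g : G), prodS (U x) g = congrS U G (prodS x g) :=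
      fun G g => (congrU_prodVec U x g).symm
    rw [inner_rightSwapS, h, inner_congrS, h, inner_congrS, inner_rightSwapS]

theorem rightSwapS_opTensorId {R : A →L[ℂ] A} (hR : R.adjoint = R) (ψ : tensor (tensor A E) F) :
    rightSwapS A E F (opTensorId (opTensorId R E) F ψ) =
      opTensorId (opTensorId R F) E (rightSwapS A E F ψ) :=
  ext_inner_prodS_left fun x f e => by
    rw [inner_rightSwapS, inner_opTensorId (adjoint_opTensorId hR), opTensorId_prodS,
      inner_opTensorId (adjoint_opTensorId hR), opTensorId_prodS, inner_rightSwapS]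

theorem IsMarginalS.conjU {ψ : tensor A B} {ρ : A →L[ℂ] A} (hρ : IsMarginalS ψ ρ)
    (U : A ≃ₗᵢ[ℂ] C) : IsMarginalS (congrS U B ψ) (conjU U ρ) :=
  IsMarginal.conjU (M := B) hρ U

theorem IsMarginalS.conj {ψ : tensor A B} {ρ : A →L[ℂ] A} (hρ : IsMarginalS ψ ρ) {Q : A →L[ℂ] A}
    (hQ : Q.adjoint = Q) : IsMarginalS (opTensorId Q B ψ) (Q ∘L ρ ∘L Q) :=
  IsMarginal.conj (M := B) hρ hQ

theorem IsMarginalS.of_unitary {ψ : tensor H A} {ψ' : tensor H B} {ρ : H →L[ℂ] H}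
    (hρ : IsMarginalS ψ ρ) (U : A ≃ₗᵢ[ℂ] B)
    (h : ∀ x z, ⟪prodS x (U z), ψ'⟫_ℂ = ⟪prodS x z, ψ⟫_ℂ) : IsMarginalS ψ' ρ :=
  IsMarginal.of_unitary (A := A) (B := B) hρ U h

theorem exists_marginalS (ψ : tensor A B) : ∃ ρ : A →L[ℂ] A, IsMarginalS ψ ρ :=
  exists_marginal (K := B) ψ

theorem IsMarginalS.comp_eq_of_forall {P : A →L[ℂ] A} (hP : P.adjoint = P) {Z : tensor A B}
    {ρ : A →L[ℂ] A} (hρ : IsMarginalS Z ρ)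
    (h : ∀ a u, ⟪prodS (P a) u, Z⟫_ℂ = ⟪prodS a u, Z⟫_ℂ) : P ∘L ρ = ρ :=
  IsMarginal.comp_eq_of_forall (B := B) hP hρ h

/-- The operator `x ⊗ z ↦ (x ⊗ k) ⊗ z` of composite systems. -/
def insertMidS (A C : HilbertSystem.{u}) (k : B) : tensor A C →L[ℂ] tensor (tensor A B) C :=
  opTensor (insertRight A k) (ContinuousLinearMap.id ℂ C)

theorem insertMidS_prodS (x : A) (k : B) (z : C) :
    insertMidS A C k (prodS x z) = prodS (prodS x k) z :=
  opTensor_prodVec (insertRight A k) (ContinuousLinearMap.id ℂ C) x z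

theorem IsMarginalS.traceMid {ψ : tensor (tensor (tensor H K) L) M}
    {ψ' : tensor (tensor H L) (tensor K M)}
    {ρ : tensor (tensor H K) L →L[ℂ] tensor (tensor H K) L} (hρ : IsMarginalS ψ ρ)
    (h : ∀ x y z w, ⟪prodS (prodS (prodS x y) z) w, ψ⟫_ℂ =
      ⟪prodS (prodS x z) (prodS y w), ψ'⟫_ℂ) :
    IsMarginalS ψ' (traceMidS ρ) := by
  have h' : ∀ (k : K) (m : M) (u : tensor H L),
      ⟪prodS (insertMidS H L k u) m, ψ⟫_ℂ = ⟪prodS u (prodS k m), ψ'⟫_ℂ := fun k m u =>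
    inner_eq_of_forall_prodS (T := insertRightS _ m ∘L insertMidS H L k)
      (S := insertRightS _ (prodS k m)) (fun x z => by
        rw [ContinuousLinearMap.comp_apply, insertMidS_prodS]
        exact h x k z m) u
  exact IsMarginal.traceAlong (H := tensor H L) (K := K) (M := M) (L := tensor (tensor H K) L)
    (V := fun k => insertMidS H L k) hρ fun u k m => h' k m u

theorem mutualInfoS_sub_mutualInfoS_eq {Y Y' : HilbertSystem.{u}}
    {X : tensor (tensor A Y) F} {X' : tensor (tensor A Y') E} {ρA : A →L[ℂ] A}
    (hfin : FiniteDimensional ℂ ρA.range) (hX : ‖X‖ = ‖X'‖)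
    (hA : IsMarginalS (assocS A Y F X) ρA) (hA' : IsMarginalS (assocS A Y' E X') ρA)
    {ρ₁ : tensor A Y →L[ℂ] tensor A Y} (h₁ : IsMarginalS X ρ₁)
    {ρ₂ : tensor A E →L[ℂ] tensor A E} (h₂ : IsMarginalS (rightSwapS A Y' E X') ρ₂)
    {ρ₃ : tensor A Y' →L[ℂ] tensor A Y'} (h₃ : IsMarginalS X' ρ₃)
    {ρ₄ : tensor A F →L[ℂ] tensor A F} (h₄ : IsMarginalS (rightSwapS A Y F X) ρ₄) :
    (mutualInfoS ρ₁ : EReal) - (mutualInfoS ρ₂ : EReal) =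
      (mutualInfoS ρ₃ : EReal) - (mutualInfoS ρ₄ : EReal) :=
  mutualInfo_sub_mutualInfo_eq (A := A) (E := E) (F := F) (Y := Y) (Y' := Y') hfin hX hA hA'
    h₁ h₂ h₃ h₄

theorem inner_rightSwapS_congrS_assocS (x : A) (y : B) (z : E) (w : F)
    (ψ : tensor (tensor (tensor A B) E) F) :
    ⟪prodS (prodS x w) (prodS y z), rightSwapS A (tensor B E) F (congrS (assocS A B E) F ψ)⟫_ℂ =
      ⟪prodS (prodS (prodS x y) z) w, ψ⟫_ℂ := by
  rw [inner_rightSwapS, ← assocS_prodS, inner_congrS]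

theorem inner_assocS_congrS_assocS (x : A) (y : B) (z : E) (w : F)
    (ψ : tensor (tensor (tensor A B) E) F) :
    ⟪prodS x (prodS (prodS y z) w), assocS A (tensor B E) F (congrS (assocS A B E) F ψ)⟫_ℂ =
      ⟪prodS (prodS (prodS x y) z) w, ψ⟫_ℂ := by
  rw [inner_assocS, ← assocS_prodS, inner_congrS]

/-- The marginal on `A ⊗ F` of a state of `A ⊗ B ⊗ E ⊗ F`, whose marginal on `A ⊗ B ⊗ F` is `ρ`. -/
theorem IsMarginalS.traceMid_rightSwapS {ψ : tensor (tensor (tensor A B) E) F}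
    {ρ : tensor (tensor A B) F →L[ℂ] tensor (tensor A B) F}
    (hρ : IsMarginalS (rightSwapS (tensor A B) E F ψ) ρ) :
    IsMarginalS (rightSwapS A (tensor B E) F (congrS (assocS A B E) F ψ)) (traceMidS ρ) :=
  hρ.traceMid fun x y z w => by
    rw [inner_rightSwapS, inner_rightSwapS_congrS_assocS]

/-- Duality of the conditional mutual information: `I(A;B|E) = I(A;B|F)` for a pure state of
`A ⊗ B ⊗ E ⊗ F`. -/
theorem condMutualInfoS_eq_of_isMarginalS {ψ : tensor (tensor (tensor A B) E) F}
    {ω : tensor (tensor A B) E →L[ℂ] tensor (tensor A B) E} (hω : IsMarginalS ψ ω)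
    {ω' : tensor (tensor A B) F →L[ℂ] tensor (tensor A B) F}
    (hω' : IsMarginalS (rightSwapS (tensor A B) E F ψ) ω') :
    condMutualInfoS ω = condMutualInfoS ω' := by
  rw [condMutualInfoS_eq, condMutualInfoS_eq]
  refine iSup_congr fun P => iSup_congr fun hP => ?_
  have hadj : P.adjoint = P := by
    rw [← ContinuousLinearMap.star_eq_adjoint]; exact hP.1.isSelfAdjoint
  have hidem : ∀ a, P (P a) = P a := fun a => congrArg (fun f => f a) hP.1.isIdempotentElem
  have hR := adjoint_opTensorId (B := B) hadj
  have hτ := hω.conj (adjoint_opTensorId (B := E) hR)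
  have hτ' := hω'.conj (adjoint_opTensorId (B := F) hR)
  rw [← rightSwapS_opTensorId hR] at hτ'
  set Ψ := opTensorId (opTensorId (opTensorId P B) E) F ψ with hΨ
  have hP' : ∀ a b e f, ⟪prodS (prodS (prodS (P a) b) e) f, Ψ⟫_ℂ =
      ⟪prodS (prodS (prodS a b) e) f, Ψ⟫_ℂ := fun a b e f => by
    rw [hΨ, inner_opTensorId (adjoint_opTensorId hR), inner_opTensorId (adjoint_opTensorId hR)]
    simp only [opTensorId_prodS, hidem]
  clear_value Ψ
  have hτ'' : IsMarginalS (rightSwapS (tensor A B) F E (rightSwapS (tensor A B) E F Ψ))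
      (opTensorId (opTensorId P B) E ∘L ω ∘L opTensorId (opTensorId P B) E) := by
    rw [rightSwapS_rightSwapS]; exact hτ
  obtain ⟨ρA, hA⟩ := exists_marginalS (assocS A (tensor B E) F (congrS (assocS A B E) F Ψ))
  -- The complement `B ⊗ E ⊗ F` of `A` is regrouped.
  have hA' : IsMarginalS (assocS A (tensor B F) E
      (congrS (assocS A B F) E (rightSwapS (tensor A B) E F Ψ))) ρA :=
    hA.of_unitary (rightSwapS B E F) fun x z =>
      inner_insert_eq_of_forall
        (U := (rightSwapS B E F).toContinuousLinearEquiv.toContinuousLinearMap) (fun b e f => by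
          change ⟪prodS x (rightSwapS B E F (prodS (prodS b e) f)), _⟫_ℂ = _
          rw [rightSwapS_prodS, inner_assocS_congrS_assocS, inner_assocS_congrS_assocS,
            inner_rightSwapS]) z
  have hPρ : P ∘L ρA = ρA := hA.comp_eq_of_forall hadj fun a u =>
    inner_insert_eq_of_forall (U := ContinuousLinearMap.id ℂ _) (fun b e f => by
      rw [ContinuousLinearMap.id_apply, inner_assocS_congrS_assocS, inner_assocS_congrS_assocS,
        hP']) u
  have hfin : FiniteDimensional ℂ ρA.range := by
    have := hP.2
    refine Submodule.finiteDimensional_of_le (S₂ := P.range) ?_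
    rintro _ ⟨y, rfl⟩
    exact ⟨ρA y, congrArg (fun f => f y) hPρ⟩
  refine mutualInfoS_sub_mutualInfoS_eq hfin ?_ hA hA' (hτ.conjU (assocS A B E))
    hτ''.traceMid_rightSwapS (hτ'.conjU (assocS A B F)) hτ'.traceMid_rightSwapS
  rw [LinearIsometryEquiv.norm_map, LinearIsometryEquiv.norm_map, LinearIsometryEquiv.norm_map]

/-- Purifications for the inductive step: the marginal on `B ⊗ E` and the regrouped operator on
`B ⊗ (C ⊗ F)` come from one vector of `(B ⊗ E) ⊗ (C ⊗ F)`. -/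
theorem exists_isMarginalS_traceMidS_conjU {ψ : tensor (tensor (tensor B C) E) F}
    {ρ : tensor (tensor B C) E →L[ℂ] tensor (tensor B C) E} (hρ : IsMarginalS ψ ρ)
    {ρ' : tensor (tensor B C) F →L[ℂ] tensor (tensor B C) F}
    (hρ' : IsMarginalS (rightSwapS (tensor B C) E F ψ) ρ') :
    ∃ ψ' : tensor (tensor B E) (tensor C F), IsMarginalS ψ' (traceMidS ρ) ∧
      IsMarginalS (rightSwapS B E (tensor C F) ψ') (conjU (assocS B C F) ρ') := by
  refine ⟨rightSwapS B (tensor C F) E (congrS (assocS B C F) E (rightSwapS (tensor B C) E F ψ)),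
    ?_, ?_⟩
  · refine IsMarginalS.traceMid_rightSwapS ?_
    rwa [rightSwapS_rightSwapS]
  · rw [rightSwapS_rightSwapS]
    exact hρ'.conjU _

theorem condMutualInfoS_conjU_eq {ψ : tensor (tensor (tensor B C) E) F}
    {ρ : tensor (tensor B C) E →L[ℂ] tensor (tensor B C) E} (hρ : IsMarginalS ψ ρ)
    {ρ' : tensor (tensor B C) F →L[ℂ] tensor (tensor B C) F}
    (hρ' : IsMarginalS (rightSwapS (tensor B C) E F ψ) ρ') :
    condMutualInfoS (conjU (congrS (swapS B C) E) ρ) =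
      condMutualInfoS (conjU (congrS (swapS B C) F) ρ') := by
  have h := hρ'.conjU (congrS (swapS B C) F)
  rw [← rightSwapS_congrS] at h
  exact condMutualInfoS_eq_of_isMarginalS (hρ.conjU (congrS (swapS B C) E)) h

end Systems

/-! ### Conditional total correlations -/

theorem condTotalCorrelation_succ {n : ℕ} (A : Fin (n + 2) → HilbertSystem.{u})
    (E : HilbertSystem.{u})
    (ρ : tensor (tensor (compose fun i => A i.castSucc) (A (Fin.last _))) E →L[ℂ]
      tensor (tensor (compose fun i => A i.castSucc) (A (Fin.last _))) E) :
    condTotalCorrelation A E ρ = condTotalCorrelation (fun i => A i.castSucc) E (traceMidS ρ) +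
      condMutualInfoS (conjU (congrS (swapS _ _) E) ρ) :=
  rfl

theorem condDualTotalCorrelation_succ {n : ℕ} (A : Fin (n + 2) → HilbertSystem.{u})
    (E : HilbertSystem.{u})
    (ρ : tensor (tensor (compose fun i => A i.castSucc) (A (Fin.last _))) E →L[ℂ]
      tensor (tensor (compose fun i => A i.castSucc) (A (Fin.last _))) E) :
    condDualTotalCorrelation A E ρ =
      condDualTotalCorrelation (fun i => A i.castSucc) (tensor (A (Fin.last _)) E)
        (conjU (assocS _ _ E) ρ) + condMutualInfoS (conjU (congrS (swapS _ _) E) ρ) :=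
  rfl

/-- The equality of the two correlations, by induction on the number of systems. The last system
`Aₘ` is traced out on one side and joins the complement `F` on the other. -/
theorem condTotalCorrelation_eq_of_isMarginalS {n : ℕ} (A : Fin (n + 1) → HilbertSystem.{u})
    (E F : HilbertSystem.{u}) (ψ : tensor (tensor (compose A) E) F)
    {ρ : tensor (compose A) E →L[ℂ] tensor (compose A) E} (hρ : IsMarginalS ψ ρ)
    {ρ' : tensor (compose A) F →L[ℂ] tensor (compose A) F}
    (hρ' : IsMarginalS (rightSwapS (compose A) E F ψ) ρ') :
    condTotalCorrelation A E ρ = condDualTotalCorrelation A F ρ' := by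
  induction n generalizing E F with
  | zero => rfl
  | succ n ih =>
    change tensor (tensor (tensor (compose fun i => A i.castSucc) (A (Fin.last _))) E) F at ψ
    change tensor (tensor (compose fun i => A i.castSucc) (A (Fin.last _))) E →L[ℂ]
      tensor (tensor (compose fun i => A i.castSucc) (A (Fin.last _))) E at ρ
    change tensor (tensor (compose fun i => A i.castSucc) (A (Fin.last _))) F →L[ℂ]
      tensor (tensor (compose fun i => A i.castSucc) (A (Fin.last _))) F at ρ'
    change IsMarginalS ψ ρ at hρ
    change IsMarginalS (rightSwapS _ E F ψ) ρ' at hρ'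
    rw [condTotalCorrelation_succ, condDualTotalCorrelation_succ]
    obtain ⟨ψ', h₁, h₂⟩ := exists_isMarginalS_traceMidS_conjU hρ hρ'
    rw [condMutualInfoS_conjU_eq hρ hρ']
    rw [ih (fun i => A i.castSucc) E _ ψ' h₁ h₂]
    rfl

end QInfo

end

theorem mainTheorem5 {n : ℕ} (A : Fin (n + 1) → QInfo.HilbertSystem.{u})
    (E F : QInfo.HilbertSystem.{u})
    (φ : (QInfo.HilbertSystem.compose A ⊗ʰ E) ⊗ʰ F →L[ℂ]
      (QInfo.HilbertSystem.compose A ⊗ʰ E) ⊗ʰ F)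
    (hφ : QInfo.IsPureState φ) :
    QInfo.condTotalCorrelation A E (QInfo.traceRight φ) =
      QInfo.condDualTotalCorrelation A F (QInfo.traceMid φ) := by
  obtain ⟨ψ, -, rfl⟩ := hφ
  exact QInfo.condTotalCorrelation_eq_of_isMarginalS A E F ψ
    (QInfo.isMarginal_traceRight_rankOne ψ) (QInfo.isMarginal_traceMid_rankOne ψ)
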